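/- **Setting.** Let $\mathbf F$ (fluents) and $\mathbf A$ (actions) be finite sets. Literals are $f$ and $\neg f$ for $f\in\mathbf F$; $\neg l$ is the complement of a literal $l$ and $\neg\sigma=\{\neg l\mid l\in\sigma\}$; a set of literals is consistent if it contains no two complementary literals. A domain description $D$ is a set of propositions $\mathbf{executable}(a,\psi)$, $\mathbf{causes}(a,l,\phi)$, $\mathbf{if}(l,\varphi)$, $\mathbf{determines}(a,\theta)$, with $a$ an action, $l$ a literal and $\psi,\phi,\varphi,\theta$ sets of literals. An action is sensing if it occurs in some $\mathbf{determines}(a,\theta)$, and non-sensing otherwise. It is assumed that: every $\varphi$ is non-empty; every $\theta$ has at least two elements; either $\theta=\{f,\neg f\}$ for a fluent $f$, or $D$ contains $\mathbf{if}(\neg g',\{g\})$ for all $g\neq g'$ in $\theta$ and $\mathbf{if}(g,\{\neg g'\mid g'\in\theta\setminus\{g\}\})$ for all $g\in\theta$; no sensing action occurs in a proposition $\mathbf{causes}$; each sensing action occurs in only one proposition $\mathbf{determines}$. A planning problem instance $P=(D,I,G)$ consists of $D$, a set $I$ of propositions $\mathbf{initially}(l)$ and a non-empty set (conjunction) $G$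 of literals; $\delta\models G$ means $G\subseteq\delta$. **Semantics.** $Cl_D(\sigma)$ is the least set of literals that includes $\sigma$ and satisfies all static laws of $D$ (for each $\mathbf{if}(l,\varphi)\in D$, if it includes $\varphi$ then it contains $l$). An a-state is a consistent set of literals satisfying all static laws; a state is a complete a-state (it contains $f$ or $\neg f$ for every $f\in\mathbf F$); an a-state is valid if it is included in a state. Action $a$ is executable in $\delta$ if $\psi\subseteq\delta$ for some $\mathbf{executable}(a,\psi)\in D$. Let $E(a,\delta)=\{l\mid \mathbf{causes}(a,l,\phi)\in D,\ \phi\subseteq\delta\}$. $D$ is consistent if for every state $s$ and every non-sensing $a$ executable in $s$ there is a state $s'=Cl_D(E(a,s)\cup(s\cap s'))$. The initial a-state is $\delta_0=Cl_D(\{l\mid\mathbf{initially}(l)\in I\})$. The action theory $(D,I)$ is consistent if $D$ is consistent and $\delta_0$ is a valid a-state. Let $e(a,\delta)=Cl_D(E(a,\delta))$ and $pc(a,\delta)=\bigcup_{i\ge 0}pc^i(a,\delta)$, where $pc^0(a,\delta)=\{l\notin\delta\mid \mathbf{causes}(a,l,\phi)\in D,\ \neg\phi\cap\delta=\emptyset\}$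 and $pc^{i+1}(a,\delta)=pc^i(a,\delta)\cup\{l\notin\delta\mid \mathbf{if}(l,\varphi)\in D,\ \varphi\cap pc^i(a,\delta)\ne\emptyset,\ \neg\varphi\cap e(a,\delta)=\emptyset\}$. If $a$ is not executable in $\delta$, then $\Phi(a,\delta)=\bot$. Otherwise, if $a$ is non-sensing, $\Phi(a,\delta)$ is $\{\delta'\}$ with $\delta'=Cl_D(e(a,\delta)\cup(\delta\setminus\neg pc(a,\delta)))$ if $\delta'$ is consistent, and $\emptyset$ if it is not; if $a$ is sensing with $\mathbf{determines}(a,\theta)$, $\Phi(a,\delta)$ is the set of the consistent sets among $Cl_D(\delta\cup\{g\})$, $g\in\theta$. Conditional plans are $[\,]$; $[a;q]$ with $a$ non-sensing and $q$ a plan; and $[a;\mathbf{cases}(\{g\to p_g\}_{g\in\theta})]$ with $\mathbf{determines}(a,\theta)\in D$ and plans $p_g$. Put $\hat\Phi([\,],\delta)=\{\delta\}$; $\hat\Phi([a;q],\delta)=\bigcup_{\delta'\in\Phi(a,\delta)}\hat\Phi(q,\delta')$; $\hat\Phi([a;\mathbf{cases}(\{g\to p_g\}_{g\in\theta})],\delta)=\bigcup_{\delta'\in\Phi(a,\delta),\,g\in\theta\cap\delta'}\hat\Phi(p_g,\delta')$;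 the value is $\bot$ if $\Phi(a,\delta)=\bot$ or if some member of the union is $\bot$. A plan $p$ is a solution to $P$ if $\hat\Phi(p,\delta_0)\ne\bot$ and $\delta\models G$ for every $\delta\in\hat\Phi(p,\delta_0)$. **Reduct.** $\mathtt{reduct}_\delta(p)=[\,]$ if $p=[\,]$ or $\delta\models G$. Otherwise: for $p=[a;q]$ it is $[a;\mathtt{reduct}_{\delta'}(q)]$ if $\Phi(a,\delta)=\{\delta'\}$ for some $\delta'$, and $[a;[\,]]$ if not; for $p=[a;\mathbf{cases}(\{g\to p_g\}_{g\in\theta})]$ it is $\mathtt{reduct}_\delta(p_g)$ if some $g\in\theta$ is in $\delta$, and $[a;\mathbf{cases}(\{g\to q_g\}_{g\in\theta})]$ if not, with $q_g=[\,]$ if $Cl_D(\delta\cup\{g\})$ is inconsistent and $q_g=\mathtt{reduct}_{Cl_D(\delta\cup\{g\})}(p_g)$ otherwise. **Encoding.** For integers $h,w\ge 1$, $\pi_{h,w}(P)$ is the following ground program, where $t$ ranges over $1..h$, $t_1$ over $1..h+1$, $k,k_1,k_2$ over $1..w$, $L,L'$ over literals, $f$ over fluents, $a$ over actions (in rules that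 come from a proposition of $D$, $a$ is the action of that proposition), $g,g_1,g_2$ over sensed literals (members of some $\theta$), and $r(\gamma,\dots)$ stands for $\{r(x,\dots)\mid x\in\gamma\}$. * Facts $time(t)$, $time1(t_1)$, $path(k)$, $action(a)$, $fluent(f)$, $sense(g)$, $literal(f)$, $literal(\neg f)$, $contrary(f,\neg f)$, $contrary(\neg f,f)$, $new\_br(k,k_1)$ for $k\le k_1$, $used(1,1)$, and $holds(l,1,1)$ for each $\mathbf{initially}(l)\in I$. * For $\mathbf{executable}(a,\psi)$: $poss(a,t,k)\leftarrow holds(\psi,t,k)$. * For $\mathbf{causes}(a,l,\phi)$: $e(l,t,k)\leftarrow occ(a,t,k),holds(\phi,t,k)$; $\ pc(l,t,k)\leftarrow occ(a,t,k),\mathrm{not}\,holds(l,t,k),\mathrm{not}\,holds(\neg\phi,t,k)$. * For $\mathbf{determines}(a,\theta)$: $\leftarrow occ(a,t,k),\mathrm{not}\,br(\theta,t,k,k)$; and for each $g\in\theta$: $1\{br(g,t,k,x): k\le x\le w\}1\leftarrow occ(a,t,k)$; $\ \leftarrow occ(a,t,k),holds(g,t,k)$. * For $\mathbf{if}(l,\varphi)$: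 $pc(l,t,k)\leftarrow \mathrm{not}\,holds(l,t,k),pc(l',t,k),\mathrm{not}\,e(\neg\varphi,t,k)$ for each $l'\in\varphi$; $\ e(l,t,k)\leftarrow e(\varphi,t,k)$; $\ holds(l,t_1,k)\leftarrow holds(\varphi,t_1,k)$. * $goal(t_1,k)\leftarrow holds(G,t_1,k)$; $\ goal(t_1,k)\leftarrow contrary(L,L'),holds(L,t_1,k),holds(L',t_1,k)$; $\ \leftarrow used(h+1,k),\mathrm{not}\,goal(h+1,k)$. * $holds(L,t+1,k)\leftarrow e(L,t,k)$; $\ holds(L,t+1,k)\leftarrow holds(L,t,k),contrary(L,L'),\mathrm{not}\,pc(L',t,k)$. * $\leftarrow br(g_1,t,k_1,k),br(g_2,t,k_2,k)$ for $k_1<k_2<k$; $\ \leftarrow br(g_1,t,k_1,k),br(g_2,t,k_1,k)$ for $k_1\le k$, $g_1\ne g_2$; $\ \leftarrow br(g,t,k_1,k),used(t,k)$ for $k_1<k$; $\ used(t+1,k)\leftarrow br(g,t,k_1,k)$ for $k_1<k$; $\ holds(g,t+1,k)\leftarrow br(g,t,k_1,k)$ for $k_1\le k$; $\ holds(L,t+1,k)\leftarrow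 br(g,t,k_1,k),holds(L,t,k_1)$ for $k_1<k$. * $1\{occ(x,t,k): x\in\mathbf A\}1\leftarrow used(t,k),\mathrm{not}\,goal(t,k)$; $\ \leftarrow occ(a,t,k),\mathrm{not}\,poss(a,t,k)$; $\ used(t+1,k)\leftarrow used(t,k)$. A set of atoms $S$ is an answer set of such a program if it satisfies all rules (a head $1\{X\}1$ holds in $S$ if exactly one element of $X$ is in $S$; an empty head never holds) and is the least model of the definite program consisting of the rules $x\leftarrow B^+$ for every rule with positive body $B^+$ none of whose negated atoms is in $S$ and whose head is the atom $x$ or is $1\{X\}1$ with $x\in X\cap S$. **Extraction.** For $1\le i\le h+1$, $1\le k\le w$, $p^k_i(S)$ is $[\,]$ if $i=h+1$ or no $occ(a,i,k)$ is in $S$; $[a;p^k_{i+1}(S)]$ if $occ(a,i,k)\in S$ with $a$ non-sensing; and $[a;\mathbf{cases}(\{g\to p^{k_g}_{i+1}(S)\}_{g\in\theta})]$ if $occ(a,i,k)\in S$ with $a$ sensing, $\mathbf{determines}(a,\theta)\in D$, and $br(g,i,k,k_g)\in S$ for each $g\in\theta$. **Theorem.** Let $P=(D,I,G)$ be a planning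 problem instance whose action theory $(D,I)$ is consistent, let $\delta_0$ be its initial a-state, and let $p$ be a solution to $P$. Then there exist integers $h\ge 1$ and $w\ge 1$ such that $\pi_{h,w}(P)$ has an answer set $S$ for which $p^1_1(S)$ is well defined and $p^1_1(S)=\mathtt{reduct}_{\delta_0}(p)$. -/

import Mathlib

/-!
# Conditional planning with sensing actions and static causal laws, and its answer set encoding
-/

namespace ASCP

open Classical in
/-- Union of a family of sets some of which may be undefined (`none` plays the role of `⊥`),
with the convention `… ∪ ⊥ ∪ … = ⊥`. -/
noncomputable def unionBot {ι β : Type*} (I : Set ι) (f : ι → Option (Set β)) :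
    Option (Set β) :=
  if ∃ i ∈ I, f i = none then none
  else some {x | ∃ i ∈ I, ∃ Y, f i = some Y ∧ x ∈ Y}

/-! ## The action language -/

/-- Fluent literals over the set `F` of fluents. -/
inductive Lit (F : Type*) where
  | pos (f : F) : Lit F
  | neg (f : F) : Lit F

/-- The complementary literal. -/
def Lit.compl {F : Type*} : Lit F → Lit F
  | .pos f => .neg f
  | .neg f => .pos f

/-- The set of complements of the members of a set of literals. -/
def complSet {F : Type*} (σ : Set (Lit F)) : Set (Lit F) := Lit.compl '' σ

/-- A set of literals is consistent if it does not contain two complementary literals. -/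
def Consistent {F : Type*} (σ : Set (Lit F)) : Prop := ∀ l ∈ σ, l.compl ∉ σ

/-- A domain description over the fluents `F` and the actions `A`, sorted by the kind of the
propositions:
* `(a, ψ) ∈ exec` is the executability condition `executable(a, ψ)`;
* `(a, l, φ) ∈ causes` is the dynamic causal law `causes(a, l, φ)`;
* `(l, φ) ∈ statics` is the static causal law `if(l, φ)`;
* `(a, θ) ∈ determines` is the knowledge proposition `determines(a, θ)`. -/
structure Domain (F A : Type*) where
  exec : Set (A × Set (Lit F))
  causes : Set (A × Lit F × Set (Lit F))
  statics : Set (Lit F × Set (Lit F))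
  determines : Set (A × Set (Lit F))

namespace Domain

variable {F A : Type*} (D : Domain F A)

/-- Sensing actions are the ones that occur in a knowledge proposition; every other action is
non-sensing. -/
def IsSensing (a : A) : Prop := ∃ θ, (a, θ) ∈ D.determines

/-- The requirements on the propositions of a domain description. -/
structure WellFormed : Prop where
  /-- no static causal law has an empty body -/
  body_nonempty : ∀ l φ, (l, φ) ∈ D.statics → φ.Nonempty
  /-- at least two literals are sensed -/
  sensed_nontrivial : ∀ a θ, (a, θ) ∈ D.determines → θ.Nontrivial
  /-- the sensed literals are two contrary literals, or the domain contains `oneof(θ)` -/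
  sensed_exclusive : ∀ a θ, (a, θ) ∈ D.determines →
    (∃ f : F, θ = {Lit.pos f, Lit.neg f}) ∨
    ((∀ g ∈ θ, ∀ g' ∈ θ, g ≠ g' → (g'.compl, {g}) ∈ D.statics) ∧
      ∀ g ∈ θ, (g, complSet (θ \ {g})) ∈ D.statics)
  /-- an action with a dynamic causal law is not a sensing action -/
  causes_nonsensing : ∀ a l φ, (a, l, φ) ∈ D.causes → ¬ D.IsSensing a
  /-- a sensing action occurs in at most one knowledge proposition -/
  determines_unique : ∀ a θ θ', (a, θ) ∈ D.determines → (a, θ') ∈ D.determines → θ = θ'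

/-- `σ` satisfies all static causal laws. -/
def SatStatics (σ : Set (Lit F)) : Prop :=
  ∀ l φ, (l, φ) ∈ D.statics → φ ⊆ σ → l ∈ σ

/-- `Cl_D(σ)`: the smallest set of literals that includes `σ` and satisfies all static laws. -/
def Cl (σ : Set (Lit F)) : Set (Lit F) := ⋂₀ {τ | σ ⊆ τ ∧ D.SatStatics τ}

/-- States: complete and consistent sets of literals satisfying all static laws. -/
def IsState (s : Set (Lit F)) : Prop :=
  (∀ f : F, Lit.pos f ∈ s ∨ Lit.neg f ∈ s) ∧ Consistent s ∧ D.SatStatics s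

/-- Approximate states. -/
def IsAState (δ : Set (Lit F)) : Prop := Consistent δ ∧ D.SatStatics δ

/-- An a-state is valid if it is a subset of some state. -/
def Valid (δ : Set (Lit F)) : Prop := D.IsAState δ ∧ ∃ s, D.IsState s ∧ δ ⊆ s

/-- `a` is executable in `δ`. -/
def Executable (a : A) (δ : Set (Lit F)) : Prop := ∃ ψ, (a, ψ) ∈ D.exec ∧ ψ ⊆ δ

/-- The direct effects `E(a, δ)`. -/
def direct (a : A) (δ : Set (Lit F)) : Set (Lit F) :=
  {l | ∃ φ, (a, l, φ) ∈ D.causes ∧ φ ⊆ δ}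

/-- The possible next states under complete information, `Res^c_D(a, s)`. -/
def resC (a : A) (s : Set (Lit F)) : Set (Set (Lit F)) :=
  {s' | D.IsState s' ∧ s' = D.Cl (D.direct a s ∪ (s ∩ s'))}

/-- Consistent domain descriptions. -/
def IsConsistent : Prop :=
  ∀ s, D.IsState s → ∀ a, ¬ D.IsSensing a → D.Executable a s → (D.resC a s).Nonempty

/-- `e(a, δ)`: what definitely holds next. -/
def e (a : A) (δ : Set (Lit F)) : Set (Lit F) := D.Cl (D.direct a δ)

/-- The sets `pc^i(a, δ)`. -/
def pcStep (a : A) (δ : Set (Lit F)) : ℕ → Set (Lit F)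
  | 0 => {l | ∃ φ, (a, l, φ) ∈ D.causes ∧ l ∉ δ ∧ complSet φ ∩ δ = ∅}
  | i + 1 => pcStep a δ i ∪
      {l | ∃ φ, (l, φ) ∈ D.statics ∧ l ∉ δ ∧ (φ ∩ pcStep a δ i).Nonempty ∧
        complSet φ ∩ D.e a δ = ∅}

/-- `pc(a, δ)`: what may change. -/
def pc (a : A) (δ : Set (Lit F)) : Set (Lit F) := ⋃ i, D.pcStep a δ i

/-- `Cl_D(e(a, δ) ∪ (δ \ ¬pc(a, δ)))`. -/
def next (a : A) (δ : Set (Lit F)) : Set (Lit F) :=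
  D.Cl (D.e a δ ∪ (δ \ complSet (D.pc a δ)))

/-- The result function for non-sensing actions: `{next a δ}`, or `∅` if it is inconsistent. -/
def resNonsensing (a : A) (δ : Set (Lit F)) : Set (Set (Lit F)) :=
  {δ' | δ' = D.next a δ ∧ Consistent δ'}

/-- The result function for sensing actions. -/
def resSensing (a : A) (δ : Set (Lit F)) : Set (Set (Lit F)) :=
  {δ' | ∃ θ, (a, θ) ∈ D.determines ∧ ∃ g ∈ θ, δ' = D.Cl (δ ∪ {g}) ∧ Consistent δ'}

open Classical in
/-- The transition function `Φ`; `none` stands for `⊥`. -/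
noncomputable def Phi (a : A) (δ : Set (Lit F)) : Option (Set (Set (Lit F))) :=
  if D.Executable a δ then
    some (if D.IsSensing a then D.resSensing a δ else D.resNonsensing a δ)
  else none

end Domain

/-! ## Conditional plans -/

/-- Conditional plans of a domain description: the empty plan, `[a; p]` for a non-sensing `a`,
and `[a; cases({g → p_g}_{g ∈ θ})]` for a sensing `a` with `determines(a, θ)`. -/
inductive Plan {F A : Type*} (D : Domain F A) where
  | empty : Plan D
  | act (a : A) (ha : ¬ D.IsSensing a) (p : Plan D) : Plan D
  | sense (a : A) (θ : Set (Lit F)) (ha : (a, θ) ∈ D.determines) (p : θ → Plan D) : Plan D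

/-- The extended transition function. -/
noncomputable def PhiHat {F A : Type*} {D : Domain F A} :
    Plan D → Set (Lit F) → Option (Set (Set (Lit F)))
  | .empty => fun δ => some {δ}
  | .act a _ q => fun δ =>
      match D.Phi a δ with
      | none => none
      | some X => unionBot X (fun δ' => PhiHat q δ')
  | .sense a θ _ p => fun δ =>
      match D.Phi a δ with
      | none => none
      | some X => unionBot {x : θ × Set (Lit F) | x.2 ∈ X ∧ x.1.1 ∈ x.2}
          (fun x => PhiHat (p x.1) x.2)

/-- A planning problem instance: a domain description, the set of the literals `l` with
`initially(l)`, and a goal (a conjunction of literals). -/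
structure Problem (F A : Type*) where
  D : Domain F A
  I : Set (Lit F)
  G : Set (Lit F)

namespace Problem

variable {F A : Type*} (P : Problem F A)

/-- The initial a-state. -/
def initialState : Set (Lit F) := P.D.Cl P.I

/-- Consistency of the action theory: the domain is consistent and the initial a-state valid. -/
def IsConsistent : Prop := P.D.IsConsistent ∧ P.D.Valid P.initialState

/-- `p` is a solution: it is executable in the initial a-state and the goal holds in every
resulting a-state. -/
def IsSolution (p : Plan P.D) : Prop :=
  ∃ X, PhiHat p P.initialState = some X ∧ ∀ δ ∈ X, P.G ⊆ δ

open Classical in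
/-- `reduct_δ(p)`. -/
noncomputable def reduct : Plan P.D → Set (Lit F) → Plan P.D
  | .empty => fun _ => .empty
  | .act a ha q => fun δ =>
      if P.G ⊆ δ then .empty
      else if h : ∃ δ', P.D.Phi a δ = some {δ'} then .act a ha (reduct q h.choose)
      else .act a ha .empty
  | .sense a θ ha p => fun δ =>
      if P.G ⊆ δ then .empty
      else if h : ∃ g : θ, g.1 ∈ δ then reduct (p h.choose) δ
      else .sense a θ ha (fun g =>
        if Consistent (P.D.Cl (δ ∪ {g.1})) then reduct (p g) (P.D.Cl (δ ∪ {g.1}))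
        else .empty)

end Problem

/-! ## Ground logic programs and answer sets -/

/-- Heads of ground rules: an atom, nothing (the rule is a constraint), or `1{X}1`. -/
inductive Head (α : Type*) where
  | atom (x : α) : Head α
  | none : Head α
  | exactlyOne (X : Set α) : Head α

/-- A ground rule `head ← pos, not neg`. -/
structure Rule (α : Type*) where
  head : Head α
  pos : Set α
  neg : Set α

/-- Satisfaction of a head in a set of atoms. -/
def Head.Sat {α : Type*} (S : Set α) : Head α → Prop
  | .atom x => x ∈ S
  | .none => False
  | .exactlyOne X => ∃! x, x ∈ X ∧ x ∈ S

/-- Satisfaction of a rule. -/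
def Rule.Sat {α : Type*} (S : Set α) (r : Rule α) : Prop :=
  r.pos ⊆ S → r.neg ∩ S = ∅ → r.head.Sat S

/-- The atoms that a head supports, relative to the candidate `S`: a choice head supports those
of its atoms that are in `S`. -/
def Head.supports {α : Type*} (S : Set α) : Head α → Set α
  | .atom x => {x}
  | .none => ∅
  | .exactlyOne X => X ∩ S

/-- The reduct of a program relative to `S`, a set of definite rules `x ← B`. -/
def glReduct {α : Type*} (Q : Set (Rule α)) (S : Set α) : Set (α × Set α) :=
  {d | ∃ r ∈ Q, r.neg ∩ S = ∅ ∧ d.1 ∈ r.head.supports S ∧ d.2 = r.pos}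

/-- The least model of a definite program. -/
def leastModel {α : Type*} (R : Set (α × Set α)) : Set α :=
  ⋂₀ {T | ∀ d ∈ R, d.2 ⊆ T → d.1 ∈ T}

/-- Answer sets (stable models) of programs with normal rules, constraints and rules with heads
`1{X}1`: `S` satisfies every rule and is the least model of the reduct relative to `S`. -/
def IsAnswerSet {α : Type*} (Q : Set (Rule α)) (S : Set α) : Prop :=
  (∀ r ∈ Q, r.Sat S) ∧ S = leastModel (glReduct Q S)

/-! ## The encoding -/

/-- Ground atoms of the encoding. -/
inductive Atom (F A : Type*) where
  | time (t : ℕ)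
  | time1 (t : ℕ)
  | path (k : ℕ)
  | fluent (f : F)
  | literal (l : Lit F)
  | contrary (l l' : Lit F)
  | isSensed (g : Lit F)
  | action (a : A)
  | holds (l : Lit F) (t k : ℕ)
  | poss (a : A) (t k : ℕ)
  | occ (a : A) (t k : ℕ)
  | e (l : Lit F) (t k : ℕ)
  | pc (l : Lit F) (t k : ℕ)
  | goal (t k : ℕ)
  | br (g : Lit F) (t k k' : ℕ)
  | used (t k : ℕ)
  | newBr (k k' : ℕ)

/-- `holds(γ, t, k)` for a set `γ` of literals. -/
def holdsSet {F A : Type*} (γ : Set (Lit F)) (t k : ℕ) : Set (Atom F A) :=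
  {x | ∃ l ∈ γ, x = .holds l t k}

/-- `e(γ, t, k)` for a set `γ` of literals. -/
def eSet {F A : Type*} (γ : Set (Lit F)) (t k : ℕ) : Set (Atom F A) :=
  {x | ∃ l ∈ γ, x = .e l t k}

/-- `br(γ, t, k, k')` for a set `γ` of literals. -/
def brSet {F A : Type*} (γ : Set (Lit F)) (t k k' : ℕ) : Set (Atom F A) :=
  {x | ∃ g ∈ γ, x = .br g t k k'}

/-- Sensed literals. -/
def Domain.sensed {F A : Type*} (D : Domain F A) : Set (Lit F) :=
  {g | ∃ a θ, (a, θ) ∈ D.determines ∧ g ∈ θ}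

/-- The ground rules of the encoding with parameters `h` and `w`. The variables range over
their sorts: `t` over `1..h` (or over `1..h+1` where this is stated), `k, k₁, k₂` over `1..w`,
`g, g₁, g₂` over the sensed literals. Comparisons are evaluated, and the conditions in the heads
`1{br(g, t, k, x) : new_br(k, x)}1` and `1{occ(x, t, k) : action(x)}1` are expanded. -/
inductive IsRule {F A : Type*} (P : Problem F A) (h w : ℕ) : Rule (Atom F A) → Prop where
  -- sorts
  | time (t : ℕ) (ht : t ∈ Set.Icc 1 h) : IsRule P h w ⟨.atom (.time t), ∅, ∅⟩
  | time1 (t : ℕ) (ht : t ∈ Set.Icc 1 (h + 1)) : IsRule P h w ⟨.atom (.time1 t), ∅, ∅⟩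
  | path (k : ℕ) (hk : k ∈ Set.Icc 1 w) : IsRule P h w ⟨.atom (.path k), ∅, ∅⟩
  | action (a : A) : IsRule P h w ⟨.atom (.action a), ∅, ∅⟩
  | fluent (f : F) : IsRule P h w ⟨.atom (.fluent f), ∅, ∅⟩
  | isSensed (g : Lit F) (hg : g ∈ P.D.sensed) : IsRule P h w ⟨.atom (.isSensed g), ∅, ∅⟩
  -- initial situation
  | initially (l : Lit F) (hl : l ∈ P.I) : IsRule P h w ⟨.atom (.holds l 1 1), ∅, ∅⟩
  -- executability conditions
  | executable (a : A) (ψ : Set (Lit F)) (ha : (a, ψ) ∈ P.D.exec)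
      (t k : ℕ) (ht : t ∈ Set.Icc 1 h) (hk : k ∈ Set.Icc 1 w) :
      IsRule P h w ⟨.atom (.poss a t k), holdsSet ψ t k, ∅⟩
  -- dynamic causal laws
  | causes_e (a : A) (l : Lit F) (φ : Set (Lit F)) (ha : (a, l, φ) ∈ P.D.causes)
      (t k : ℕ) (ht : t ∈ Set.Icc 1 h) (hk : k ∈ Set.Icc 1 w) :
      IsRule P h w ⟨.atom (.e l t k), {.occ a t k} ∪ holdsSet φ t k, ∅⟩
  | causes_pc (a : A) (l : Lit F) (φ : Set (Lit F)) (ha : (a, l, φ) ∈ P.D.causes)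
      (t k : ℕ) (ht : t ∈ Set.Icc 1 h) (hk : k ∈ Set.Icc 1 w) :
      IsRule P h w ⟨.atom (.pc l t k), {.occ a t k},
        {.holds l t k} ∪ holdsSet (complSet φ) t k⟩
  -- knowledge propositions
  | determines_stay (a : A) (θ : Set (Lit F)) (ha : (a, θ) ∈ P.D.determines)
      (t k : ℕ) (ht : t ∈ Set.Icc 1 h) (hk : k ∈ Set.Icc 1 w) :
      IsRule P h w ⟨.none, {.occ a t k}, brSet θ t k k⟩
  | determines_branch (a : A) (θ : Set (Lit F)) (ha : (a, θ) ∈ P.D.determines)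
      (g : Lit F) (hg : g ∈ θ)
      (t k : ℕ) (ht : t ∈ Set.Icc 1 h) (hk : k ∈ Set.Icc 1 w) :
      IsRule P h w ⟨.exactlyOne {y | ∃ x ∈ Set.Icc 1 w, k ≤ x ∧ y = .br g t k x},
        {.occ a t k}, ∅⟩
  | determines_unknown (a : A) (θ : Set (Lit F)) (ha : (a, θ) ∈ P.D.determines)
      (g : Lit F) (hg : g ∈ θ)
      (t k : ℕ) (ht : t ∈ Set.Icc 1 h) (hk : k ∈ Set.Icc 1 w) :
      IsRule P h w ⟨.none, {.occ a t k, .holds g t k}, ∅⟩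
  -- static causal laws
  | static_pc (l : Lit F) (φ : Set (Lit F)) (hl : (l, φ) ∈ P.D.statics)
      (l' : Lit F) (hl' : l' ∈ φ)
      (t k : ℕ) (ht : t ∈ Set.Icc 1 h) (hk : k ∈ Set.Icc 1 w) :
      IsRule P h w ⟨.atom (.pc l t k), {.pc l' t k},
        {.holds l t k} ∪ eSet (complSet φ) t k⟩
  | static_e (l : Lit F) (φ : Set (Lit F)) (hl : (l, φ) ∈ P.D.statics)
      (t k : ℕ) (ht : t ∈ Set.Icc 1 h) (hk : k ∈ Set.Icc 1 w) :
      IsRule P h w ⟨.atom (.e l t k), eSet φ t k, ∅⟩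
  | static_holds (l : Lit F) (φ : Set (Lit F)) (hl : (l, φ) ∈ P.D.statics)
      (t k : ℕ) (ht : t ∈ Set.Icc 1 (h + 1)) (hk : k ∈ Set.Icc 1 w) :
      IsRule P h w ⟨.atom (.holds l t k), holdsSet φ t k, ∅⟩
  -- goal
  | goal (t k : ℕ) (ht : t ∈ Set.Icc 1 (h + 1)) (hk : k ∈ Set.Icc 1 w) :
      IsRule P h w ⟨.atom (.goal t k), holdsSet P.G t k, ∅⟩
  | goal_inconsistent (l l' : Lit F)
      (t k : ℕ) (ht : t ∈ Set.Icc 1 (h + 1)) (hk : k ∈ Set.Icc 1 w) :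
      IsRule P h w ⟨.atom (.goal t k),
        {.contrary l l', .holds l t k, .holds l' t k}, ∅⟩
  | goal_reached (k : ℕ) (hk : k ∈ Set.Icc 1 w) :
      IsRule P h w ⟨.none, {.used (h + 1) k}, {.goal (h + 1) k}⟩
  -- effects of non-sensing actions and inertia
  | effect (l : Lit F) (t k : ℕ) (ht : t ∈ Set.Icc 1 h) (hk : k ∈ Set.Icc 1 w) :
      IsRule P h w ⟨.atom (.holds l (t + 1) k), {.e l t k}, ∅⟩
  | inertia (l l' : Lit F) (t k : ℕ) (ht : t ∈ Set.Icc 1 h) (hk : k ∈ Set.Icc 1 w) :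
      IsRule P h w ⟨.atom (.holds l (t + 1) k),
        {.holds l t k, .contrary l l'}, {.pc l' t k}⟩
  -- branches created by sensing actions
  | branch_source (g₁ g₂ : Lit F) (hg₁ : g₁ ∈ P.D.sensed) (hg₂ : g₂ ∈ P.D.sensed)
      (t k₁ k₂ k : ℕ) (ht : t ∈ Set.Icc 1 h) (hk₁ : k₁ ∈ Set.Icc 1 w)
      (hk₂ : k₂ ∈ Set.Icc 1 w) (hk : k ∈ Set.Icc 1 w) (h₁₂ : k₁ < k₂) (h₂ : k₂ < k) :
      IsRule P h w ⟨.none, {.br g₁ t k₁ k, .br g₂ t k₂ k}, ∅⟩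
  | branch_label (g₁ g₂ : Lit F) (hg₁ : g₁ ∈ P.D.sensed) (hg₂ : g₂ ∈ P.D.sensed)
      (t k₁ k : ℕ) (ht : t ∈ Set.Icc 1 h) (hk₁ : k₁ ∈ Set.Icc 1 w)
      (hk : k ∈ Set.Icc 1 w) (h₁ : k₁ ≤ k) (hne : g₁ ≠ g₂) :
      IsRule P h w ⟨.none, {.br g₁ t k₁ k, .br g₂ t k₁ k}, ∅⟩
  | branch_fresh (g : Lit F) (hg : g ∈ P.D.sensed)
      (t k₁ k : ℕ) (ht : t ∈ Set.Icc 1 h) (hk₁ : k₁ ∈ Set.Icc 1 w)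
      (hk : k ∈ Set.Icc 1 w) (h₁ : k₁ < k) :
      IsRule P h w ⟨.none, {.br g t k₁ k, .used t k}, ∅⟩
  | branch_used (g : Lit F) (hg : g ∈ P.D.sensed)
      (t k₁ k : ℕ) (ht : t ∈ Set.Icc 1 h) (hk₁ : k₁ ∈ Set.Icc 1 w)
      (hk : k ∈ Set.Icc 1 w) (h₁ : k₁ < k) :
      IsRule P h w ⟨.atom (.used (t + 1) k), {.br g t k₁ k}, ∅⟩
  | branch_sensed (g : Lit F) (hg : g ∈ P.D.sensed)
      (t k₁ k : ℕ) (ht : t ∈ Set.Icc 1 h) (hk₁ : k₁ ∈ Set.Icc 1 w)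
      (hk : k ∈ Set.Icc 1 w) (h₁ : k₁ ≤ k) :
      IsRule P h w ⟨.atom (.holds g (t + 1) k), {.br g t k₁ k}, ∅⟩
  | branch_inherit (g : Lit F) (hg : g ∈ P.D.sensed) (l : Lit F)
      (t k₁ k : ℕ) (ht : t ∈ Set.Icc 1 h) (hk₁ : k₁ ∈ Set.Icc 1 w)
      (hk : k ∈ Set.Icc 1 w) (h₁ : k₁ < k) :
      IsRule P h w ⟨.atom (.holds l (t + 1) k), {.br g t k₁ k, .holds l t k₁}, ∅⟩
  -- action occurrences
  | occ_choice (t k : ℕ) (ht : t ∈ Set.Icc 1 h) (hk : k ∈ Set.Icc 1 w) :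
      IsRule P h w ⟨.exactlyOne {y | ∃ a : A, y = .occ a t k}, {.used t k}, {.goal t k}⟩
  | occ_poss (a : A) (t k : ℕ) (ht : t ∈ Set.Icc 1 h) (hk : k ∈ Set.Icc 1 w) :
      IsRule P h w ⟨.none, {.occ a t k}, {.poss a t k}⟩
  -- auxiliary rules
  | literal_pos (f : F) : IsRule P h w ⟨.atom (.literal (.pos f)), ∅, ∅⟩
  | literal_neg (f : F) : IsRule P h w ⟨.atom (.literal (.neg f)), ∅, ∅⟩
  | contrary_pos (f : F) : IsRule P h w ⟨.atom (.contrary (.pos f) (.neg f)), ∅, ∅⟩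
  | contrary_neg (f : F) : IsRule P h w ⟨.atom (.contrary (.neg f) (.pos f)), ∅, ∅⟩
  | newBr (k k₁ : ℕ) (hk : k ∈ Set.Icc 1 w) (hk₁ : k₁ ∈ Set.Icc 1 w) (hle : k ≤ k₁) :
      IsRule P h w ⟨.atom (.newBr k k₁), ∅, ∅⟩
  | used_root : IsRule P h w ⟨.atom (.used 1 1), ∅, ∅⟩
  | used_next (t k : ℕ) (ht : t ∈ Set.Icc 1 h) (hk : k ∈ Set.Icc 1 w) :
      IsRule P h w ⟨.atom (.used (t + 1) k), {.used t k}, ∅⟩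

/-- The program `π_{h,w}(P)`. -/
def program {F A : Type*} (P : Problem F A) (h w : ℕ) : Set (Rule (Atom F A)) :=
  {r | IsRule P h w r}

/-- `Extracts D h S i k q`: the plan `q` is (a value of) `p^k_i(S)`, the plan read off from the
set of atoms `S` at time `i` and path `k`. -/
inductive Extracts {F A : Type*} (D : Domain F A) (h : ℕ) (S : Set (Atom F A)) :
    ℕ → ℕ → Plan D → Prop where
  | empty (i k : ℕ) (hi : i = h + 1 ∨ ∀ a, Atom.occ a i k ∉ S) : Extracts D h S i k .empty
  | act (i k : ℕ) (hi : i ≤ h) (a : A) (ha : ¬ D.IsSensing a) (hocc : Atom.occ a i k ∈ S)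
      (q : Plan D) (hq : Extracts D h S (i + 1) k q) : Extracts D h S i k (.act a ha q)
  | sense (i k : ℕ) (hi : i ≤ h) (a : A) (θ : Set (Lit F)) (ha : (a, θ) ∈ D.determines)
      (hocc : Atom.occ a i k ∈ S) (κ : θ → ℕ) (hκ : ∀ g, Atom.br g.1 i k (κ g) ∈ S)
      (q : θ → Plan D) (hq : ∀ g, Extracts D h S (i + 1) (κ g) (q g)) :
      Extracts D h S i k (.sense a θ ha q)

end ASCP


/-!
The reduct of a solution acts only where the goal does not hold yet and senses only what is not
known. Set aside for the remaining plan `q` on path `k` the `q.size` path numbers from `k` on.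
Sensing divides this interval among the cases, one of which stays on path `k`. Intervals set aside
at the same time are disjoint, so a time and a path number determine the literals known and the plan
that remains. Hence the atoms that describe the execution of the reduct satisfy the rules of the
encoding. Conversely, following the execution in time derives each of these atoms, so that they form
an answer set. The plan is read back from the actions and branches recorded in it.
-/

namespace ASCP

variable {F A : Type*}

@[simp]
theorem Lit.compl_compl (l : Lit F) : l.compl.compl = l := by cases l <;> rfl

instance [Finite F] : Finite (Lit F) :=
  Finite.of_surjective (Sum.elim Lit.pos Lit.neg) fun
    | .pos f => ⟨.inl f, rfl⟩
    | .neg f => ⟨.inr f, rfl⟩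

namespace Domain

variable {D : Domain F A} {a : A} {δ σ τ : Set (Lit F)}

theorem subset_Cl (σ : Set (Lit F)) : σ ⊆ D.Cl σ := fun _ hl _ hτ => hτ.1 hl

theorem Cl_subset (h : σ ⊆ τ) (hτ : D.SatStatics τ) : D.Cl σ ⊆ τ := fun _ hl => hl τ ⟨h, hτ⟩

theorem satStatics_Cl (σ : Set (Lit F)) : D.SatStatics (D.Cl σ) :=
  fun l φ hlφ hφ τ hτ => hτ.2 l φ hlφ fun _ hm => hφ hm τ hτ

theorem Cl_eq_self (hσ : D.SatStatics σ) : D.Cl σ = σ :=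
  (Cl_subset subset_rfl hσ).antisymm (subset_Cl σ)

theorem pcStep_zero_subset_pc (a : A) (δ : Set (Lit F)) : D.pcStep a δ 0 ⊆ D.pc a δ :=
  Set.subset_iUnion (D.pcStep a δ) 0

theorem mem_pc_of_static {l l' : Lit F} {φ : Set (Lit F)} (h : (l, φ) ∈ D.statics) (hl : l ∉ δ)
    (hl' : l' ∈ φ) (hpc : l' ∈ D.pc a δ) (hφ : complSet φ ∩ D.e a δ = ∅) : l ∈ D.pc a δ := by
  obtain ⟨i, hi⟩ := Set.mem_iUnion.1 hpc
  exact Set.mem_iUnion.2 ⟨i + 1, Or.inr ⟨φ, h, hl, ⟨l', hl', hi⟩, hφ⟩⟩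

theorem Phi_of_not_executable (hex : ¬ D.Executable a δ) : D.Phi a δ = none := if_neg hex

theorem Phi_of_nonsensing (hex : D.Executable a δ) (ha : ¬ D.IsSensing a) :
    D.Phi a δ = some (D.resNonsensing a δ) := by
  rw [Phi, if_pos hex, if_neg ha]

theorem Phi_of_sensing (hex : D.Executable a δ) (ha : D.IsSensing a) :
    D.Phi a δ = some (D.resSensing a δ) := by
  rw [Phi, if_pos hex, if_pos ha]

theorem Phi_eq_some_singleton_iff (hex : D.Executable a δ) (ha : ¬ D.IsSensing a) :
    D.Phi a δ = some {σ} ↔ σ = D.next a δ ∧ Consistent (D.next a δ) := by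
  rw [Phi_of_nonsensing hex ha, Option.some.injEq, Set.eq_singleton_iff_unique_mem]
  constructor
  · rintro ⟨⟨hσ, hc⟩, -⟩
    exact ⟨hσ, hσ ▸ hc⟩
  · rintro ⟨rfl, hc⟩
    exact ⟨⟨rfl, hc⟩, fun _ h => h.1⟩

/-- The conditions on a domain description under which its plans are encoded faithfully. By
`sensed_finite`, a plan is executed on finitely many paths. -/
structure Admissible (D : Domain F A) : Prop where
  body_nonempty : ∀ l φ, (l, φ) ∈ D.statics → φ.Nonempty
  sensed_nonempty : ∀ a θ, (a, θ) ∈ D.determines → θ.Nonempty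
  sensed_finite : ∀ a θ, (a, θ) ∈ D.determines → θ.Finite
  causes_nonsensing : ∀ a l φ, (a, l, φ) ∈ D.causes → ¬ D.IsSensing a
  determines_unique : ∀ a θ θ', (a, θ) ∈ D.determines → (a, θ') ∈ D.determines → θ = θ'

theorem WellFormed.admissible [Finite F] (hwf : D.WellFormed) : D.Admissible where
  body_nonempty := hwf.body_nonempty
  sensed_nonempty a θ ha := (hwf.sensed_nontrivial a θ ha).nonempty
  sensed_finite _ θ _ := θ.toFinite
  causes_nonsensing := hwf.causes_nonsensing
  determines_unique := hwf.determines_unique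

namespace Admissible

theorem e_sensing (hD : D.Admissible) (ha : D.IsSensing a) (δ : Set (Lit F)) : D.e a δ = ∅ := by
  have hdirect : D.direct a δ = ∅ :=
    Set.eq_empty_of_forall_notMem fun _ ⟨_, h, _⟩ => hD.causes_nonsensing _ _ _ h ha
  have hstatics : D.SatStatics ∅ := fun l φ hl hφ =>
    ((hD.body_nonempty l φ hl).ne_empty (Set.subset_empty_iff.1 hφ)).elim
  rw [e, hdirect, Cl_eq_self hstatics]

theorem pc_sensing (hD : D.Admissible) (ha : D.IsSensing a) (δ : Set (Lit F)) :
    D.pc a δ = ∅ := by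
  refine Set.iUnion_eq_empty.2 fun i => ?_
  induction i with
  | zero => exact Set.eq_empty_of_forall_notMem fun _ ⟨_, h, _⟩ => hD.causes_nonsensing _ _ _ h ha
  | succ i ih => simp [pcStep, ih]

end Admissible

end Domain

theorem exists_subset_of_unionBot_eq_some {ι β : Type*} {I : Set ι} {f : ι → Option (Set β)}
    {X : Set β} (h : unionBot I f = some X) {i : ι} (hi : i ∈ I) : ∃ Y ⊆ X, f i = some Y := by
  unfold unionBot at h
  split_ifs at h with hnone
  obtain ⟨Y, hY⟩ := Option.ne_none_iff_exists'.1 fun hfi => hnone ⟨i, hi, hfi⟩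
  refine ⟨Y, fun x hx => ?_, hY⟩
  rw [← Option.some.inj h]
  exact ⟨i, hi, Y, hY, hx⟩

/-! ## Reduced solutions -/

namespace Plan

variable {D : Domain F A}

/-- The first action of a plan. -/
def first : Plan D → Option A
  | .empty => none
  | .act a _ _ => some a
  | .sense a _ _ _ => some a

theorem eq_empty_of_first_eq_none {q : Plan D} (h : q.first = none) : q = .empty := by
  cases q <;> first | rfl | cases h

theorem eq_sense_of_first (hD : D.Admissible) {q : Plan D} {a : A} {θ : Set (Lit F)}
    (hq : q.first = some a) (ha : (a, θ) ∈ D.determines) : ∃ r, q = .sense a θ ha r := by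
  cases q with
  | empty => cases hq
  | act b hb r =>
    cases hq
    exact (hb ⟨θ, ha⟩).elim
  | sense b θ' hb r =>
    cases hq
    cases hD.determines_unique _ _ _ hb ha
    exact ⟨r, rfl⟩

theorem eq_act_of_first {q : Plan D} {a : A} (hq : q.first = some a) (ha : ¬ D.IsSensing a) :
    ∃ r, q = .act a ha r := by
  cases q with
  | empty => cases hq
  | act b hb r =>
    cases hq
    exact ⟨r, rfl⟩
  | sense b θ hb r =>
    cases hq
    exact (ha ⟨θ, hb⟩).elim

end Plan

namespace Problem

variable {P : Problem F A} {a : A} {δ θ : Set (Lit F)}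

/-- `p` achieves the goal from the a-state `δ`; for the initial a-state, this is `IsSolution`. -/
def Solves (P : Problem F A) (p : Plan P.D) (δ : Set (Lit F)) : Prop :=
  ∃ X, PhiHat p δ = some X ∧ ∀ δ' ∈ X, P.G ⊆ δ'

namespace Solves

theorem goal_subset (h : P.Solves .empty δ) : P.G ⊆ δ := by
  obtain ⟨_, ⟨⟩, hG⟩ := h
  exact hG δ rfl

theorem executable {p : Plan P.D} (h : P.Solves p δ) (ha : p.first = some a) :
    P.D.Executable a δ := by
  obtain ⟨X, hX, -⟩ := h
  by_contra hex
  cases p <;> cases ha <;> simp [PhiHat, Domain.Phi_of_not_executable hex] at hX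

theorem of_act {ha : ¬ P.D.IsSensing a} {q : Plan P.D} (h : P.Solves (.act a ha q) δ)
    (hc : Consistent (P.D.next a δ)) : P.Solves q (P.D.next a δ) := by
  have hex := h.executable rfl
  obtain ⟨X, hX, hG⟩ := h
  simp only [PhiHat, Domain.Phi_of_nonsensing hex ha] at hX
  obtain ⟨Y, hYX, hY⟩ := exists_subset_of_unionBot_eq_some hX (i := P.D.next a δ) ⟨rfl, hc⟩
  exact ⟨Y, hY, fun δ' h => hG δ' (hYX h)⟩

theorem of_sense {ha : (a, θ) ∈ P.D.determines} {q : θ → Plan P.D}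
    (h : P.Solves (.sense a θ ha q) δ) (g : θ) (hc : Consistent (P.D.Cl (δ ∪ {g.1}))) :
    P.Solves (q g) (P.D.Cl (δ ∪ {g.1})) := by
  have hex := h.executable rfl
  obtain ⟨X, hX, hG⟩ := h
  simp only [PhiHat, Domain.Phi_of_sensing hex ⟨θ, ha⟩] at hX
  obtain ⟨Y, hYX, hY⟩ := exists_subset_of_unionBot_eq_some hX (i := (g, P.D.Cl (δ ∪ {g.1})))
    ⟨⟨θ, ha, g.1, g.2, rfl, hc⟩, Domain.subset_Cl _ (Or.inr rfl)⟩
  exact ⟨Y, hY, fun δ' h => hG δ' (hYX h)⟩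

end Solves

theorem reduct_of_goal_subset (hG : P.G ⊆ δ) (p : Plan P.D) : P.reduct p δ = .empty := by
  cases p <;> simp [reduct, hG]

theorem reduct_act_of_consistent {ha : ¬ P.D.IsSensing a} (q : Plan P.D) (hG : ¬ P.G ⊆ δ)
    (hex : P.D.Executable a δ) (hc : Consistent (P.D.next a δ)) :
    P.reduct (.act a ha q) δ = .act a ha (P.reduct q (P.D.next a δ)) := by
  have h : ∃ δ', P.D.Phi a δ = some {δ'} :=
    ⟨_, (Domain.Phi_eq_some_singleton_iff hex ha).2 ⟨rfl, hc⟩⟩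
  simp only [reduct, if_neg hG, dif_pos h,
    ((Domain.Phi_eq_some_singleton_iff hex ha).1 h.choose_spec).1]

theorem reduct_act_of_not_consistent {ha : ¬ P.D.IsSensing a} (q : Plan P.D) (hG : ¬ P.G ⊆ δ)
    (hex : P.D.Executable a δ) (hc : ¬ Consistent (P.D.next a δ)) :
    P.reduct (.act a ha q) δ = .act a ha .empty := by
  have h : ¬ ∃ δ', P.D.Phi a δ = some {δ'} := fun ⟨_, h⟩ =>
    hc ((Domain.Phi_eq_some_singleton_iff hex ha).1 h).2
  simp only [reduct, if_neg hG, dif_neg h]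

theorem exists_reduct_sense_eq {ha : (a, θ) ∈ P.D.determines} (q : θ → Plan P.D)
    (hG : ¬ P.G ⊆ δ) (h : ∃ g : θ, g.1 ∈ δ) :
    ∃ g : θ, g.1 ∈ δ ∧ P.reduct (.sense a θ ha q) δ = P.reduct (q g) δ :=
  ⟨h.choose, h.choose_spec, by simp only [reduct, if_neg hG, dif_pos h]⟩

open Classical in
theorem reduct_sense_of_unknown {ha : (a, θ) ∈ P.D.determines} (q : θ → Plan P.D)
    (hG : ¬ P.G ⊆ δ) (h : ¬ ∃ g : θ, g.1 ∈ δ) :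
    P.reduct (.sense a θ ha q) δ = .sense a θ ha fun g =>
      if Consistent (P.D.Cl (δ ∪ {g.1})) then P.reduct (q g) (P.D.Cl (δ ∪ {g.1})) else .empty := by
  simp only [reduct, if_neg hG, dif_neg h]

/-- `P.IsReducedSolution δ q`: the plan `q` is executable in `δ`, acts only where the goal does
not hold yet, senses only what is not known, and ends in sets of literals that include the goal or
are inconsistent. The inconsistent ones are the outcomes that `Φ` discards. -/
inductive IsReducedSolution (P : Problem F A) : Set (Lit F) → Plan P.D → Prop where
  | empty (δ : Set (Lit F)) (h : P.G ⊆ δ ∨ ¬ Consistent δ) : P.IsReducedSolution δ .empty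
  | act (δ : Set (Lit F)) (a : A) (ha : ¬ P.D.IsSensing a) (q : Plan P.D)
      (hG : ¬ P.G ⊆ δ) (hδ : Consistent δ) (hex : P.D.Executable a δ)
      (hq : P.IsReducedSolution (P.D.next a δ) q) : P.IsReducedSolution δ (.act a ha q)
  | sense (δ : Set (Lit F)) (a : A) (θ : Set (Lit F)) (ha : (a, θ) ∈ P.D.determines)
      (q : θ → Plan P.D) (hG : ¬ P.G ⊆ δ) (hδ : Consistent δ) (hex : P.D.Executable a δ)
      (hθ : ∀ g ∈ θ, g ∉ δ) (hq : ∀ g : θ, P.IsReducedSolution (P.D.Cl (δ ∪ {g.1})) (q g)) :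
      P.IsReducedSolution δ (.sense a θ ha q)

namespace IsReducedSolution

variable {q : Plan P.D}

theorem first_eq_none_iff (h : P.IsReducedSolution δ q) :
    q.first = none ↔ P.G ⊆ δ ∨ ¬ Consistent δ := by
  cases h with
  | empty _ h => exact iff_of_true rfl h
  | act _ _ _ _ hG hδ => exact iff_of_false nofun (not_or.2 ⟨hG, not_not.2 hδ⟩)
  | sense _ _ _ _ _ hG hδ => exact iff_of_false nofun (not_or.2 ⟨hG, not_not.2 hδ⟩)

theorem executable (h : P.IsReducedSolution δ q) (hq : q.first = some a) :
    P.D.Executable a δ := by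
  cases h <;> cases hq <;> assumption

theorem notMem_of_mem_sensed {ha : (a, θ) ∈ P.D.determines} {q : θ → Plan P.D}
    (h : P.IsReducedSolution δ (.sense a θ ha q)) {g : Lit F} (hg : g ∈ θ) : g ∉ δ := by
  cases h with
  | sense _ _ _ _ _ _ _ _ hθ => exact hθ g hg

end IsReducedSolution

theorem Solves.isReducedSolution_reduct {p : Plan P.D} (hp : P.Solves p δ)
    (hδ : P.D.IsAState δ) : P.IsReducedSolution δ (P.reduct p δ) := by
  induction p generalizing δ with
  | empty => exact .empty _ (Or.inl hp.goal_subset)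
  | act a ha q ih =>
    by_cases hG : P.G ⊆ δ
    · exact reduct_of_goal_subset hG _ ▸ .empty _ (Or.inl hG)
    have hex := hp.executable rfl
    by_cases hc : Consistent (P.D.next a δ)
    · rw [reduct_act_of_consistent q hG hex hc]
      exact .act _ _ _ _ hG hδ.1 hex (ih (hp.of_act hc) ⟨hc, Domain.satStatics_Cl _⟩)
    · rw [reduct_act_of_not_consistent q hG hex hc]
      exact .act _ _ _ _ hG hδ.1 hex (.empty _ (Or.inr hc))
  | sense a θ ha q ih =>
    by_cases hG : P.G ⊆ δ
    · exact reduct_of_goal_subset hG _ ▸ .empty _ (Or.inl hG)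
    have ih (g : θ) (hc : Consistent (P.D.Cl (δ ∪ {g.1}))) :=
      ih g (hp.of_sense g hc) ⟨hc, Domain.satStatics_Cl _⟩
    by_cases hknown : ∃ g : θ, g.1 ∈ δ
    · obtain ⟨g, hg, hreduct⟩ := exists_reduct_sense_eq (ha := ha) q hG hknown
      have hCl : P.D.Cl (δ ∪ {g.1}) = δ := by
        rw [Set.union_eq_self_of_subset_right (Set.singleton_subset_iff.2 hg),
          Domain.Cl_eq_self hδ.2]
      rw [hreduct]
      exact hCl ▸ ih g (hCl.symm ▸ hδ.1)
    · rw [reduct_sense_of_unknown q hG hknown]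
      refine .sense _ _ _ _ _ hG hδ.1 (hp.executable rfl)
        (fun g hg hgδ => hknown ⟨⟨g, hg⟩, hgδ⟩) fun g => ?_
      split_ifs with hc
      · exact ih g hc
      · exact .empty _ (Or.inr hc)

end Problem

/-! ## Allocation of paths -/

section Offset

variable {ι : Type*}

/-- The start of the `i`-th interval when consecutive intervals of lengths `L j` are laid out
from `0` on, in an arbitrary fixed order of the indices. -/
noncomputable def offset (L : ι → ℕ) (i : ι) : ℕ := ∑ᶠ j ∈ {j | WellOrderingRel j i}, L j

theorem exists_offset_eq_zero [Nonempty ι] (L : ι → ℕ) : ∃ i, offset L i = 0 := by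
  obtain ⟨i, -, hi⟩ := WellOrderingRel.isWellOrder.wf.has_min (Set.univ : Set ι) Set.univ_nonempty
  have hempty : {j | WellOrderingRel j i} = ∅ :=
    Set.eq_empty_of_forall_notMem fun j => hi j trivial
  exact ⟨i, by rw [offset, hempty, finsum_mem_empty]⟩

variable [Finite ι] (L : ι → ℕ)

theorem finsum_mem_le_finsum_mem_of_subset {s t : Set ι} (h : s ⊆ t) :
    ∑ᶠ i ∈ s, L i ≤ ∑ᶠ i ∈ t, L i :=
  (Nat.le_add_right _ _).trans_eq (finsum_mem_add_sdiff h t.toFinite)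

theorem offset_add_le_finsum_mem {i : ι} {s : Set ι} (hs : ∀ j, WellOrderingRel j i → j ∈ s)
    (hi : i ∈ s) : offset L i + L i ≤ ∑ᶠ j ∈ s, L j := by
  have hirrefl : i ∉ {j | WellOrderingRel j i} := irrefl_of WellOrderingRel i
  rw [offset, add_comm, ← finsum_mem_insert L hirrefl (Set.toFinite _)]
  exact finsum_mem_le_finsum_mem_of_subset L (Set.insert_subset hi hs)

theorem offset_add_le_finsum (i : ι) : offset L i + L i ≤ ∑ᶠ j, L j := by
  simpa only [finsum_mem_univ] using
    offset_add_le_finsum_mem L (s := Set.univ) (fun _ _ => trivial) trivial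

theorem offset_add_le_offset {i j : ι} (h : WellOrderingRel i j) :
    offset L i + L i ≤ offset L j :=
  offset_add_le_finsum_mem L (fun _ hm => trans_of WellOrderingRel hm h) h

theorem eq_of_mem_Ico_offset {i j : ι} {m : ℕ}
    (hi : m ∈ Set.Ico (offset L i) (offset L i + L i))
    (hj : m ∈ Set.Ico (offset L j) (offset L j + L j)) : i = j := by
  rcases trichotomous_of WellOrderingRel i j with h | h | h
  · exact absurd (hi.2.trans_le (offset_add_le_offset L h)) hj.1.not_gt
  · exact h
  · exact absurd (hj.2.trans_le (offset_add_le_offset L h)) hi.1.not_gt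

theorem offset_injective {L : ι → ℕ} (hL : ∀ i, 0 < L i) : Function.Injective (offset L) :=
  fun i j h => eq_of_mem_Ico_offset L (m := offset L i) ⟨le_rfl, Nat.lt_add_of_pos_right (hL i)⟩
    ⟨h.ge, h ▸ Nat.lt_add_of_pos_right (hL j)⟩

end Offset

namespace Plan

variable {D : Domain F A}

/-- The number of nodes of a plan. It bounds the duration of the plan as well as the number of
paths on which it is executed. -/
noncomputable def size : Plan D → ℕ
  | .empty => 1
  | .act _ _ q => 1 + size q
  | .sense _ _ _ q => 1 + ∑ᶠ g, size (q g)

theorem size_pos (q : Plan D) : 0 < q.size := by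
  cases q <;> simp [size]

end Plan

/-! ## Execution -/

/-- A stage of the execution of a plan on one path: the number of the path, the literals known
on it, and the plan that remains to be executed. -/
structure Config (P : Problem F A) where
  path : ℕ
  known : Set (Lit F)
  plan : Plan P.D

section Execution

variable {P : Problem F A}

/-- The paths set aside for the execution of the remaining plan. -/
noncomputable def Config.reserved (c : Config P) : Set ℕ := Set.Ico c.path (c.path + c.plan.size)

theorem Config.path_mem_reserved (c : Config P) : c.path ∈ c.reserved :=
  ⟨le_rfl, Nat.lt_add_of_pos_right c.plan.size_pos⟩

/-- One step of the execution. Sensing divides the reserved paths, except for the last one, among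
the cases. -/
inductive Step : Config P → Config P → Prop where
  | idle (k : ℕ) (δ : Set (Lit F)) : Step ⟨k, δ, .empty⟩ ⟨k, δ, .empty⟩
  | act (k : ℕ) (δ : Set (Lit F)) (a : A) (ha : ¬ P.D.IsSensing a) (q : Plan P.D) :
      Step ⟨k, δ, .act a ha q⟩ ⟨k, P.D.next a δ, q⟩
  | sense (k : ℕ) (δ : Set (Lit F)) (a : A) (θ : Set (Lit F)) (ha : (a, θ) ∈ P.D.determines)
      (q : θ → Plan P.D) (g : θ) :
      Step ⟨k, δ, .sense a θ ha q⟩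
        ⟨k + offset (fun g => (q g).size) g, P.D.Cl (δ ∪ {g.1}), q g⟩

/-- `Reach P p t c`: when `p` is executed from the initial a-state, starting at time `1` on
path `1`, then `c` is one of the configurations at time `t`. -/
inductive Reach (P : Problem F A) (p : Plan P.D) : ℕ → Config P → Prop where
  | root : Reach P p 1 ⟨1, P.initialState, p⟩
  | step {t : ℕ} {c c' : Config P} (h : Reach P p t c) (hs : Step c c') : Reach P p (t + 1) c'

namespace Step

variable {c c' c₁ c₂ : Config P}

theorem size_lt (hD : P.D.Admissible) (h : Step c c') (hc : c.plan ≠ .empty) :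
    c'.plan.size < c.plan.size := by
  cases h with
  | idle => exact (hc rfl).elim
  | act => simp [Plan.size]
  | sense k δ a θ ha q g =>
    have := (hD.sensed_finite a θ ha).to_subtype
    have := offset_add_le_finsum (fun g => (q g).size) g
    simp only [Plan.size]
    omega

theorem reserved_subset (hD : P.D.Admissible) (h : Step c c') : c'.reserved ⊆ c.reserved := by
  cases h with
  | idle => exact subset_rfl
  | act => exact Set.Ico_subset_Ico_right (by simp [Plan.size])
  | sense k δ a θ ha q g =>
    have := (hD.sensed_finite a θ ha).to_subtype
    have := offset_add_le_finsum (fun g => (q g).size) g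
    refine Set.Ico_subset_Ico (Nat.le_add_right _ _) ?_
    simp only [Plan.size]
    omega

theorem eq_of_mem_reserved (hD : P.D.Admissible) (h₁ : Step c c₁) (h₂ : Step c c₂) {m : ℕ}
    (hm₁ : m ∈ c₁.reserved) (hm₂ : m ∈ c₂.reserved) : c₁ = c₂ := by
  cases h₁ with
  | idle => cases h₂; rfl
  | act => cases h₂; rfl
  | sense k δ a θ ha q g =>
    cases h₂ with
    | sense _ _ _ _ _ _ g' =>
      have := (hD.sensed_finite a θ ha).to_subtype
      simp only [Config.reserved, Set.mem_Ico] at hm₁ hm₂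
      obtain rfl : g = g' := eq_of_mem_Ico_offset (fun g => (q g).size) (m := m - k)
        ⟨by omega, by omega⟩ ⟨by omega, by omega⟩
      rfl

end Step

variable {p q q' : Plan P.D} {t k k' : ℕ} {δ δ' : Set (Lit F)} {c c' : Config P}

namespace Reach

theorem one_le_time (h : Reach P p t c) : 1 ≤ t := by
  cases h <;> simp

theorem eq_root (h : Reach P p 1 c) : c = ⟨1, P.initialState, p⟩ := by
  generalize ht : 1 = t at h
  cases h with
  | root => rfl
  | step h => have := h.one_le_time; omega

theorem exists_step (h : Reach P p (t + 1) c) (ht : 1 ≤ t) :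
    ∃ c₀, Reach P p t c₀ ∧ Step c₀ c := by
  generalize hs : t + 1 = s at h
  cases h with
  | root => omega
  | step h hstep =>
    obtain rfl := Nat.succ.inj hs
    exact ⟨_, h, hstep⟩

theorem eq_of_mem_reserved (hD : P.D.Admissible) (h : Reach P p t c) (h' : Reach P p t c') {m : ℕ}
    (hm : m ∈ c.reserved) (hm' : m ∈ c'.reserved) : c = c' := by
  induction h generalizing c' with
  | root => exact h'.eq_root.symm
  | step h hs ih =>
    obtain ⟨c₀, h₀, hs₀⟩ := h'.exists_step h.one_le_time
    obtain rfl := ih h₀ (hs.reserved_subset hD hm) (hs₀.reserved_subset hD hm')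
    exact hs.eq_of_mem_reserved hD hs₀ hm hm'

theorem unique (hD : P.D.Admissible) (h : Reach P p t ⟨k, δ, q⟩) (h' : Reach P p t ⟨k, δ', q'⟩) :
    δ = δ' ∧ q = q' := by
  have heq := h.eq_of_mem_reserved hD h' (Config.path_mem_reserved _) (Config.path_mem_reserved _)
  exact (Config.mk.inj heq).2

theorem path_mem_Icc (hD : P.D.Admissible) (h : Reach P p t c) : c.path ∈ Set.Icc 1 p.size := by
  suffices hsub : c.reserved ⊆ Set.Icc 1 p.size from hsub c.path_mem_reserved
  induction h with
  | root =>
    intro m hm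
    simp only [Config.reserved, Set.mem_Ico] at hm
    exact ⟨hm.1, by omega⟩
  | step _ hs ih => exact (hs.reserved_subset hD).trans ih

theorem time_add_size_le (hD : P.D.Admissible) (h : Reach P p t c) (hc : c.plan ≠ .empty) :
    t + c.plan.size ≤ 1 + p.size := by
  induction h with
  | root => exact le_rfl
  | @step t c₀ c _ hs ih =>
    have hc₀ : c₀.plan ≠ .empty := by
      cases hs
      · exact fun _ => hc rfl
      · exact nofun
      · exact nofun
    have := hs.size_lt hD hc₀
    have := ih hc₀
    omega

theorem time_mem_Icc (hD : P.D.Admissible) (h : Reach P p t c) {a : A}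
    (hc : c.plan.first = some a) : t ∈ Set.Icc 1 p.size := by
  have hne : c.plan ≠ .empty := fun h => by simp [h, Plan.first] at hc
  have := h.time_add_size_le hD hne
  have := c.plan.size_pos
  exact ⟨h.one_le_time, by omega⟩

theorem satStatics (h : Reach P p t c) : P.D.SatStatics c.known := by
  induction h with
  | root => exact Domain.satStatics_Cl _
  | step _ hs ih =>
    cases hs with
    | idle => exact ih
    | act => exact Domain.satStatics_Cl _
    | sense => exact Domain.satStatics_Cl _

theorem isReducedSolution (hp : P.IsReducedSolution P.initialState p) (h : Reach P p t c) :
    P.IsReducedSolution c.known c.plan := by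
  induction h with
  | root => exact hp
  | step _ hs ih =>
    cases hs with
    | idle => exact ih
    | act => cases ih; assumption
    | sense _ _ _ _ _ _ g =>
      cases ih with
      | sense _ _ _ _ _ _ _ _ _ hq => exact hq g

end Reach

/-- The literals known at time `t` on path `k`; there are none if the path is not in use. -/
def known (P : Problem F A) (p : Plan P.D) (t k : ℕ) : Set (Lit F) :=
  {l | ∃ δ q, Reach P p t ⟨k, δ, q⟩ ∧ l ∈ δ}

/-- Action `a` occurs at time `t` on path `k`. -/
def Occurs (P : Problem F A) (p : Plan P.D) (a : A) (t k : ℕ) : Prop :=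
  ∃ δ q, Reach P p t ⟨k, δ, q⟩ ∧ q.first = some a

/-- At time `t`, the case `g` of the plan on path `k` is continued on path `k'`. -/
def Branches (P : Problem F A) (p : Plan P.D) (g : Lit F) (t k k' : ℕ) : Prop :=
  ∃ δ a θ, ∃ ha : (a, θ) ∈ P.D.determines, ∃ q : θ → Plan P.D, ∃ hg : g ∈ θ,
    Reach P p t ⟨k, δ, .sense a θ ha q⟩ ∧ k' = k + offset (fun g => (q g).size) ⟨g, hg⟩

theorem Reach.known_eq (hD : P.D.Admissible) (h : Reach P p t ⟨k, δ, q⟩) : known P p t k = δ := by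
  refine Set.Subset.antisymm ?_ fun l hl => ⟨δ, q, h, hl⟩
  rintro l ⟨δ', q', h', hl⟩
  exact (h.unique hD h').1 ▸ hl

theorem satStatics_known (hD : P.D.Admissible) (t k : ℕ) : P.D.SatStatics (known P p t k) := by
  intro l φ hl hφ
  obtain ⟨m, hm⟩ := hD.body_nonempty l φ hl
  obtain ⟨δ, q, h, -⟩ := hφ hm
  rw [h.known_eq hD] at hφ ⊢
  exact h.satStatics l φ hl hφ

theorem Reach.occurs_iff (hD : P.D.Admissible) (h : Reach P p t ⟨k, δ, q⟩) {a : A} :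
    Occurs P p a t k ↔ q.first = some a := by
  refine ⟨?_, fun hq => ⟨δ, q, h, hq⟩⟩
  rintro ⟨δ', q', h', hq⟩
  rwa [(h.unique hD h').2]

namespace Occurs

variable {a b : A}

theorem unique (hD : P.D.Admissible) (ha : Occurs P p a t k) (hb : Occurs P p b t k) : a = b := by
  obtain ⟨δ, q, h, hq⟩ := ha
  exact Option.some.inj (hq.symm.trans ((h.occurs_iff hD).1 hb))

theorem exists_reach_sense (hD : P.D.Admissible) {θ : Set (Lit F)} (h : Occurs P p a t k)
    (ha : (a, θ) ∈ P.D.determines) : ∃ δ r, Reach P p t ⟨k, δ, .sense a θ ha r⟩ := by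
  obtain ⟨δ, q, h, hq⟩ := h
  obtain ⟨r, rfl⟩ := Plan.eq_sense_of_first hD hq ha
  exact ⟨δ, r, h⟩

theorem exists_reach_act (h : Occurs P p a t k) (ha : ¬ P.D.IsSensing a) :
    ∃ δ r, Reach P p t ⟨k, δ, .act a ha r⟩ := by
  obtain ⟨δ, q, h, hq⟩ := h
  obtain ⟨r, rfl⟩ := Plan.eq_act_of_first hq ha
  exact ⟨δ, r, h⟩

end Occurs

namespace Reach

variable {a : A} {θ : Set (Lit F)} {ha : (a, θ) ∈ P.D.determines} {q : θ → Plan P.D}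

theorem branches (h : Reach P p t ⟨k, δ, .sense a θ ha q⟩) (g : θ) :
    Branches P p g t k (k + offset (fun g => (q g).size) g) :=
  ⟨δ, a, θ, ha, q, g.2, h, rfl⟩

theorem branches_iff (hD : P.D.Admissible) (h : Reach P p t ⟨k, δ, .sense a θ ha q⟩) (g : θ) :
    Branches P p g t k k' ↔ k' = k + offset (fun g => (q g).size) g := by
  refine ⟨?_, fun hk => hk ▸ h.branches g⟩
  rintro ⟨δ', a', θ', ha', q', hg, h', hk⟩
  cases (h.unique hD h').2
  exact hk

theorem exists_branches_self (hD : P.D.Admissible) (h : Reach P p t ⟨k, δ, .sense a θ ha q⟩) :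
    ∃ g : θ, Branches P p g t k k := by
  have := (hD.sensed_nonempty a θ ha).to_subtype
  obtain ⟨g, hg⟩ := exists_offset_eq_zero fun g => (q g).size
  exact ⟨g, (h.branches_iff hD g).2 (by rw [hg, add_zero])⟩

end Reach

namespace Branches

variable {g g' : Lit F} {k₁ k₂ : ℕ}

theorem exists_reach (hD : P.D.Admissible) (h : Branches P p g t k k') :
    ∃ q, Reach P p (t + 1) ⟨k', P.D.Cl (known P p t k ∪ {g}), q⟩ := by
  obtain ⟨δ, a, θ, ha, q, hg, h, rfl⟩ := h
  rw [h.known_eq hD]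
  exact ⟨q ⟨g, hg⟩, h.step (.sense _ _ _ _ _ _ ⟨g, hg⟩)⟩

theorem exists_mem_reserved (hD : P.D.Admissible) (h : Branches P p g t k k') :
    ∃ δ q, Reach P p t ⟨k, δ, q⟩ ∧ k' ∈ Config.reserved ⟨k, δ, q⟩ := by
  obtain ⟨δ, a, θ, ha, q, hg, h, rfl⟩ := h
  exact ⟨δ, _, h, (Step.sense k δ a θ ha q ⟨g, hg⟩).reserved_subset hD (Config.path_mem_reserved _)⟩

theorem label_unique (hD : P.D.Admissible) (h : Branches P p g t k k')
    (h' : Branches P p g' t k k') : g = g' := by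
  obtain ⟨δ, a, θ, ha, q, hg, h, rfl⟩ := h
  obtain ⟨_, _, _, _, _, hg', h₁, heq⟩ := h'
  cases (h.unique hD h₁).2
  have := (hD.sensed_finite a θ ha).to_subtype
  exact congrArg Subtype.val
    (offset_injective (fun g => (q g).size_pos) (Nat.add_left_cancel heq) :
      (⟨g, hg⟩ : θ) = ⟨g', hg'⟩)

theorem eq_of_reach (hD : P.D.Admissible) (h : Branches P p g t k k')
    (h' : Reach P p t ⟨k', δ, q⟩) : k = k' := by
  obtain ⟨δ₁, q₁, h₁, hk⟩ := h.exists_mem_reserved hD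
  exact congrArg Config.path (h₁.eq_of_mem_reserved hD h' hk (Config.path_mem_reserved _))

theorem source_unique (hD : P.D.Admissible) (h₁ : Branches P p g t k₁ k)
    (h₂ : Branches P p g' t k₂ k) : k₁ = k₂ := by
  obtain ⟨δ₁, q₁, h₁, hk₁⟩ := h₁.exists_mem_reserved hD
  obtain ⟨δ₂, q₂, h₂, hk₂⟩ := h₂.exists_mem_reserved hD
  exact congrArg Config.path (h₁.eq_of_mem_reserved hD h₂ hk₁ hk₂)

end Branches

theorem Reach.exists_reach_succ (hD : P.D.Admissible) (h : Reach P p t ⟨k, δ, q⟩) :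
    ∃ δ' q', Reach P p (t + 1) ⟨k, δ', q'⟩ := by
  cases q with
  | empty => exact ⟨_, _, h.step (.idle _ _)⟩
  | act a ha q => exact ⟨_, _, h.step (.act _ _ _ _ _)⟩
  | sense a θ ha q =>
    obtain ⟨g, hg⟩ := h.exists_branches_self hD
    exact ⟨_, hg.exists_reach hD⟩

theorem mem_known_of_effect (hD : P.D.Admissible) {l : Lit F} {a : A} (ha : Occurs P p a t k)
    (hl : l ∈ P.D.e a (known P p t k)) : l ∈ known P p (t + 1) k := by
  have hs : ¬ P.D.IsSensing a := fun hs => by simp [hD.e_sensing hs] at hl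
  obtain ⟨δ, r, h⟩ := ha.exists_reach_act hs
  rw [h.known_eq hD] at hl
  exact ⟨_, _, h.step (.act _ _ _ _ _), Domain.subset_Cl _ (Or.inl hl)⟩

theorem mem_known_of_inertia (hD : P.D.Admissible) {l : Lit F} (hl : l ∈ known P p t k)
    (hpc : ∀ a, Occurs P p a t k → l.compl ∉ P.D.pc a (known P p t k)) :
    l ∈ known P p (t + 1) k := by
  obtain ⟨δ, q, h, hlδ⟩ := id hl
  cases q with
  | empty => exact ⟨_, _, h.step (.idle _ _), hlδ⟩
  | act a ha q =>
    have hl' : l ∉ complSet (P.D.pc a δ) := by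
      rintro ⟨m, hm, rfl⟩
      have := hpc a ((h.occurs_iff hD).2 rfl)
      rw [h.known_eq hD, Lit.compl_compl] at this
      exact this hm
    exact ⟨_, _, h.step (.act _ _ _ _ _), Domain.subset_Cl _ (Or.inr ⟨hlδ, hl'⟩)⟩
  | sense a θ ha q =>
    obtain ⟨g, hg⟩ := h.exists_branches_self hD
    obtain ⟨q', h'⟩ := hg.exists_reach hD
    exact ⟨_, _, h', Domain.subset_Cl _ (Or.inl hl)⟩

/-! ## The answer set -/

/-- Membership in the answer set that describes the execution of `p`. -/
def InAnswerSet (P : Problem F A) (p : Plan P.D) : Atom F A → Prop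
  | .time t => t ∈ Set.Icc 1 p.size
  | .time1 t => t ∈ Set.Icc 1 (p.size + 1)
  | .path k => k ∈ Set.Icc 1 p.size
  | .fluent _ => True
  | .literal _ => True
  | .contrary l l' => l' = l.compl
  | .isSensed g => g ∈ P.D.sensed
  | .action _ => True
  | .holds l t k => t ≤ p.size + 1 ∧ l ∈ known P p t k
  | .poss a t k => t ∈ Set.Icc 1 p.size ∧ k ∈ Set.Icc 1 p.size ∧
      P.D.Executable a (known P p t k)
  | .occ a t k => Occurs P p a t k
  | .e l t k => ∃ a, Occurs P p a t k ∧ l ∈ P.D.e a (known P p t k)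
  | .pc l t k => ∃ a, Occurs P p a t k ∧ l ∈ P.D.pc a (known P p t k)
  | .goal t k => t ∈ Set.Icc 1 (p.size + 1) ∧ k ∈ Set.Icc 1 p.size ∧
      (P.G ⊆ known P p t k ∨ ¬ Consistent (known P p t k))
  | .br g t k k' => Branches P p g t k k'
  | .used t k => t ≤ p.size + 1 ∧ ∃ δ q, Reach P p t ⟨k, δ, q⟩
  | .newBr k k' => k ∈ Set.Icc 1 p.size ∧ k ≤ k' ∧ k' ∈ Set.Icc 1 p.size

/-- The answer set that describes the execution of `p`. -/
def answerSet (P : Problem F A) (p : Plan P.D) : Set (Atom F A) := {x | InAnswerSet P p x}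

theorem holdsSet_subset_iff {σ : Set (Lit F)} {S : Set (Atom F A)} :
    holdsSet σ t k ⊆ S ↔ ∀ l ∈ σ, .holds l t k ∈ S :=
  ⟨fun h l hl => h ⟨l, hl, rfl⟩, fun h _ ⟨l, hl, hx⟩ => hx ▸ h l hl⟩

theorem eSet_subset_iff {σ : Set (Lit F)} {S : Set (Atom F A)} :
    eSet σ t k ⊆ S ↔ ∀ l ∈ σ, .e l t k ∈ S :=
  ⟨fun h l hl => h ⟨l, hl, rfl⟩, fun h _ ⟨l, hl, hx⟩ => hx ▸ h l hl⟩

theorem subset_known_of_holdsSet_subset {σ : Set (Lit F)} (h : holdsSet σ t k ⊆ answerSet P p) :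
    σ ⊆ known P p t k :=
  fun l hl => (holdsSet_subset_iff.1 h l hl).2

theorem holdsSet_inter_answerSet_eq_empty_iff (ht : t ≤ p.size + 1) (σ : Set (Lit F)) :
    holdsSet σ t k ∩ answerSet P p = ∅ ↔ σ ∩ known P p t k = ∅ := by
  simp only [← Set.disjoint_iff_inter_eq_empty, Set.disjoint_left]
  constructor
  · exact fun h l hl hknown => h ⟨l, hl, rfl⟩ ⟨ht, hknown⟩
  · rintro h _ ⟨l, hl, rfl⟩ ⟨-, hknown⟩
    exact h hl hknown

theorem eSet_inter_answerSet_eq_empty_iff (hD : P.D.Admissible) {a : A} (ha : Occurs P p a t k)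
    (σ : Set (Lit F)) :
    eSet σ t k ∩ answerSet P p = ∅ ↔ σ ∩ P.D.e a (known P p t k) = ∅ := by
  simp only [← Set.disjoint_iff_inter_eq_empty, Set.disjoint_left]
  constructor
  · exact fun h l hl he => h ⟨l, hl, rfl⟩ ⟨a, ha, he⟩
  · rintro h _ ⟨l, hl, rfl⟩ ⟨b, hb, he⟩
    obtain rfl := ha.unique hD hb
    exact h hl he

theorem Reach.goal_mem_answerSet_iff (hD : P.D.Admissible)
    (hp : P.IsReducedSolution P.initialState p) (h : Reach P p t ⟨k, δ, q⟩)
    (ht : t ≤ p.size + 1) : .goal t k ∈ answerSet P p ↔ q.first = none := by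
  have hδ : InAnswerSet P p (.goal t k) ↔ P.G ⊆ known P p t k ∨ ¬ Consistent (known P p t k) :=
    (and_iff_right ⟨h.one_le_time, ht⟩).trans (and_iff_right (h.path_mem_Icc hD))
  rw [h.known_eq hD] at hδ
  exact hδ.trans (h.isReducedSolution hp).first_eq_none_iff.symm

/-! ### Satisfaction of the rules -/

section Sat

variable {l : Lit F} {pos neg : Set (Atom F A)}

theorem sat_answerSet_of_holds (hD : P.D.Admissible)
    (hr : IsRule P p.size p.size ⟨.atom (.holds l t k), pos, neg⟩) :
    Rule.Sat (answerSet P p) ⟨.atom (.holds l t k), pos, neg⟩ := by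
  intro hpos hneg
  cases hr with
  | initially _ hl => exact ⟨Nat.le_add_left _ _, _, _, .root, Domain.subset_Cl _ hl⟩
  | static_holds _ φ hl _ _ ht =>
    exact ⟨ht.2, satStatics_known hD t k l φ hl (subset_known_of_holdsSet_subset hpos)⟩
  | effect _ _ _ ht =>
    obtain ⟨a, ha, hl⟩ := Set.singleton_subset_iff.1 hpos
    exact ⟨Nat.succ_le_succ ht.2, mem_known_of_effect hD ha hl⟩
  | inertia _ l' _ _ ht =>
    obtain ⟨⟨-, hl⟩, rfl : l' = l.compl⟩ := Set.pair_subset_iff.1 hpos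
    exact ⟨Nat.succ_le_succ ht.2, mem_known_of_inertia hD hl fun a ha hpc =>
      Set.singleton_inter_eq_empty.1 hneg ⟨a, ha, hpc⟩⟩
  | branch_sensed _ _ _ _ _ ht =>
    have hb := Set.singleton_subset_iff.1 hpos
    obtain ⟨q, h⟩ := Branches.exists_reach hD hb
    exact ⟨Nat.succ_le_succ ht.2, _, q, h, Domain.subset_Cl _ (Or.inr rfl)⟩
  | branch_inherit _ _ _ _ _ _ ht =>
    obtain ⟨hb, -, hl⟩ := Set.pair_subset_iff.1 hpos
    obtain ⟨q, h⟩ := Branches.exists_reach hD hb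
    exact ⟨Nat.succ_le_succ ht.2, _, q, h, Domain.subset_Cl _ (Or.inl hl)⟩

theorem sat_answerSet_of_e (hD : P.D.Admissible)
    (hr : IsRule P p.size p.size ⟨.atom (.e l t k), pos, neg⟩) :
    Rule.Sat (answerSet P p) ⟨.atom (.e l t k), pos, neg⟩ := by
  intro hpos _
  cases hr with
  | causes_e a _ φ ha =>
    obtain ⟨hocc, hφ⟩ := Set.union_subset_iff.1 hpos
    have hocc := Set.singleton_subset_iff.1 hocc
    exact ⟨a, hocc, Domain.subset_Cl _
      ⟨φ, ha, subset_known_of_holdsSet_subset hφ⟩⟩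
  | static_e _ φ hl =>
    have hφ := eSet_subset_iff.1 hpos
    obtain ⟨m, hm⟩ := hD.body_nonempty l φ hl
    obtain ⟨a, ha, -⟩ := hφ m hm
    refine ⟨a, ha, Domain.satStatics_Cl _ l φ hl fun m hm => ?_⟩
    obtain ⟨b, hb, he⟩ := hφ m hm
    exact ha.unique hD hb ▸ he

theorem sat_answerSet_of_pc (hD : P.D.Admissible)
    (hr : IsRule P p.size p.size ⟨.atom (.pc l t k), pos, neg⟩) :
    Rule.Sat (answerSet P p) ⟨.atom (.pc l t k), pos, neg⟩ := by
  intro hpos hneg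
  cases hr with
  | causes_pc a _ φ ha _ _ ht =>
    have ht := Nat.le_succ_of_le ht.2
    obtain ⟨hl, hφ⟩ := Set.union_empty_iff.1 (Set.union_inter_distrib_right .. ▸ hneg)
    have hocc := Set.singleton_subset_iff.1 hpos
    exact ⟨a, hocc, Domain.pcStep_zero_subset_pc _ _
      ⟨φ, ha, fun h => Set.singleton_inter_eq_empty.1 hl ⟨ht, h⟩,
        (holdsSet_inter_answerSet_eq_empty_iff ht _).1 hφ⟩⟩
  | static_pc _ φ hlφ l' hl' _ _ ht =>
    obtain ⟨hl, hφ⟩ := Set.union_empty_iff.1 (Set.union_inter_distrib_right .. ▸ hneg)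
    obtain ⟨a, ha, hpc⟩ := Set.singleton_subset_iff.1 hpos
    exact ⟨a, ha, Domain.mem_pc_of_static hlφ
      (fun h => Set.singleton_inter_eq_empty.1 hl ⟨Nat.le_succ_of_le ht.2, h⟩) hl' hpc
      ((eSet_inter_answerSet_eq_empty_iff hD ha _).1 hφ)⟩

theorem sat_answerSet_of_goal (hr : IsRule P p.size p.size ⟨.atom (.goal t k), pos, neg⟩) :
    Rule.Sat (answerSet P p) ⟨.atom (.goal t k), pos, neg⟩ := by
  intro hpos _
  cases hr with
  | goal _ _ ht hk => exact ⟨ht, hk, Or.inl (subset_known_of_holdsSet_subset hpos)⟩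
  | goal_inconsistent l l' _ _ ht hk =>
    obtain ⟨rfl : l' = l.compl, hpos⟩ := Set.insert_subset_iff.1 hpos
    obtain ⟨⟨-, hl⟩, -, hl'⟩ := Set.pair_subset_iff.1 hpos
    exact ⟨ht, hk, Or.inr fun h => h l hl hl'⟩

theorem sat_answerSet_of_used (hD : P.D.Admissible)
    (hr : IsRule P p.size p.size ⟨.atom (.used t k), pos, neg⟩) :
    Rule.Sat (answerSet P p) ⟨.atom (.used t k), pos, neg⟩ := by
  intro hpos _
  cases hr with
  | used_root => exact ⟨Nat.le_add_left _ _, _, _, .root⟩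
  | used_next _ _ ht =>
    obtain ⟨-, δ, q, h⟩ := Set.singleton_subset_iff.1 hpos
    exact ⟨Nat.succ_le_succ ht.2, h.exists_reach_succ hD⟩
  | branch_used _ _ _ _ _ ht =>
    have hb := Set.singleton_subset_iff.1 hpos
    obtain ⟨q, h⟩ := Branches.exists_reach hD hb
    exact ⟨Nat.succ_le_succ ht.2, _, q, h⟩

theorem sat_answerSet_of_exactlyOne (hD : P.D.Admissible)
    (hp : P.IsReducedSolution P.initialState p) {X : Set (Atom F A)}
    (hr : IsRule P p.size p.size ⟨.exactlyOne X, pos, neg⟩) :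
    Rule.Sat (answerSet P p) ⟨.exactlyOne X, pos, neg⟩ := by
  intro hpos hneg
  cases hr with
  | determines_branch a θ ha g hg t k =>
    have hocc := Set.singleton_subset_iff.1 hpos
    obtain ⟨δ, r, h⟩ := Occurs.exists_reach_sense hD hocc ha
    have hb := h.branches ⟨g, hg⟩
    obtain ⟨q, h'⟩ := hb.exists_reach hD
    refine ⟨.br g t k _, ⟨⟨_, h'.path_mem_Icc hD, Nat.le_add_right _ _, rfl⟩, hb⟩, ?_⟩
    rintro _ ⟨⟨x, -, -, rfl⟩, hx⟩
    rw [(h.branches_iff hD ⟨g, hg⟩).1 hx]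
  | occ_choice t k =>
    obtain ⟨ht, δ, q, h⟩ := Set.singleton_subset_iff.1 hpos
    have hfirst : q.first ≠ none := fun hq =>
      Set.singleton_inter_eq_empty.1 hneg ((h.goal_mem_answerSet_iff hD hp ht).2 hq)
    obtain ⟨a, ha⟩ := Option.ne_none_iff_exists'.1 hfirst
    have hocc := (h.occurs_iff hD).2 ha
    refine ⟨.occ a t k, ⟨⟨a, rfl⟩, hocc⟩, ?_⟩
    rintro _ ⟨⟨b, rfl⟩, hb⟩
    rw [hocc.unique hD hb]

theorem sat_answerSet_of_constraint (hD : P.D.Admissible)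
    (hp : P.IsReducedSolution P.initialState p)
    (hr : IsRule P p.size p.size ⟨.none, pos, neg⟩) :
    Rule.Sat (answerSet P p) ⟨.none, pos, neg⟩ := by
  intro hpos hneg
  cases hr with
  | determines_stay a θ ha t k =>
    have hocc := Set.singleton_subset_iff.1 hpos
    obtain ⟨δ, r, h⟩ := Occurs.exists_reach_sense hD hocc ha
    obtain ⟨g, hg⟩ := h.exists_branches_self hD
    exact Set.disjoint_left.1 (Set.disjoint_iff_inter_eq_empty.2 hneg) ⟨g.1, g.2, rfl⟩ hg
  | determines_unknown a θ ha g hg =>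
    obtain ⟨hocc, -, hgδ⟩ := Set.pair_subset_iff.1 hpos
    obtain ⟨δ, r, h⟩ := Occurs.exists_reach_sense hD hocc ha
    exact (h.isReducedSolution hp).notMem_of_mem_sensed hg (h.known_eq hD ▸ hgδ)
  | goal_reached k =>
    obtain ⟨ht, δ, q, h⟩ := Set.singleton_subset_iff.1 hpos
    have hgoal := (h.goal_mem_answerSet_iff hD hp ht).not.1 (Set.singleton_inter_eq_empty.1 hneg)
    obtain ⟨a, ha⟩ := Option.ne_none_iff_exists'.1 hgoal
    exact absurd (h.time_mem_Icc hD ha).2 (Nat.not_succ_le_self _)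
  | branch_source _ _ _ _ _ _ _ _ _ _ _ _ h₁₂ =>
    obtain ⟨hb₁, hb₂⟩ := Set.pair_subset_iff.1 hpos
    exact h₁₂.ne (Branches.source_unique hD hb₁ hb₂)
  | branch_label _ _ _ _ _ _ _ _ _ _ _ hne =>
    obtain ⟨hb₁, hb₂⟩ := Set.pair_subset_iff.1 hpos
    exact hne (Branches.label_unique hD hb₁ hb₂)
  | branch_fresh _ _ _ _ _ _ _ _ hlt =>
    obtain ⟨hb, -, δ, q, h⟩ := Set.pair_subset_iff.1 hpos
    exact hlt.ne (Branches.eq_of_reach hD hb h)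
  | occ_poss a t k ht hk =>
    obtain ⟨δ, q, h, ha⟩ := Set.singleton_subset_iff.1 hpos
    refine Set.singleton_inter_eq_empty.1 hneg ⟨ht, hk, ?_⟩
    rw [h.known_eq hD]
    exact (h.isReducedSolution hp).executable ha

theorem sat_answerSet_of_mem_program (hD : P.D.Admissible)
    (hp : P.IsReducedSolution P.initialState p) :
    ∀ r ∈ program P p.size p.size, r.Sat (answerSet P p) := by
  rintro ⟨head, pos, neg⟩ hr
  cases head with
  | none => exact sat_answerSet_of_constraint hD hp hr
  | exactlyOne X => exact sat_answerSet_of_exactlyOne hD hp hr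
  | atom x =>
    cases x with
    | holds l t k => exact sat_answerSet_of_holds hD hr
    | e l t k => exact sat_answerSet_of_e hD hr
    | pc l t k => exact sat_answerSet_of_pc hD hr
    | goal t k => exact sat_answerSet_of_goal hr
    | used t k => exact sat_answerSet_of_used hD hr
    | poss a t k =>
      cases hr with
      | executable _ ψ ha _ _ ht hk =>
        exact fun hpos _ => ⟨ht, hk, ψ, ha, subset_known_of_holdsSet_subset hpos⟩
    | time | time1 | path | isSensed => cases hr with | _ => exact fun _ _ => ‹_›
    | action | fluent | literal => cases hr <;> exact fun _ _ => trivial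
    | contrary => cases hr <;> exact fun _ _ => rfl
    | newBr k k' => cases hr with | newBr _ _ hk hk' hle => exact fun _ _ => ⟨hk, hle, hk'⟩
    | occ | br => cases hr

end Sat

/-! ### Derivation of the atoms -/

section LeastModel

variable {α : Type*}

theorem mem_leastModel_of_mem {R : Set (α × Set α)} {x : α} {B : Set α} (h : (x, B) ∈ R)
    (hB : B ⊆ leastModel R) : x ∈ leastModel R :=
  fun _ hT => hT _ h (hB.trans (Set.sInter_subset_of_mem hT))

theorem leastModel_glReduct_subset {Q : Set (Rule α)} {S : Set α} (h : ∀ r ∈ Q, r.Sat S) :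
    leastModel (glReduct Q S) ⊆ S := by
  refine Set.sInter_subset_of_mem ?_
  rintro ⟨x, _⟩ ⟨⟨head, pos, neg⟩, hr, hneg, hx, rfl⟩ hpos
  cases head with
  | atom y => exact Set.mem_singleton_iff.1 hx ▸ h _ hr hpos hneg
  | none => exact hx.elim
  | exactlyOne X => exact hx.2

end LeastModel

/-- The least model of the reduct of the encoding relative to `answerSet P p`. -/
def derived (P : Problem F A) (p : Plan P.D) : Set (Atom F A) :=
  leastModel (glReduct (program P p.size p.size) (answerSet P p))

section Rules

variable {x : Atom F A} {head : Head (Atom F A)} {pos neg : Set (Atom F A)}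

theorem mem_derived_of_isRule (hr : IsRule P p.size p.size ⟨head, pos, neg⟩)
    (hx : x ∈ head.supports (answerSet P p)) (hpos : pos ⊆ derived P p)
    (hneg : neg ∩ answerSet P p = ∅) : x ∈ derived P p :=
  mem_leastModel_of_mem ⟨_, hr, hneg, hx, rfl⟩ hpos

theorem atom_mem_derived (hr : IsRule P p.size p.size ⟨.atom x, pos, ∅⟩)
    (hpos : pos ⊆ derived P p) : x ∈ derived P p :=
  mem_derived_of_isRule hr rfl hpos (Set.empty_inter _)

theorem fact_mem_derived (hr : IsRule P p.size p.size ⟨.atom x, ∅, ∅⟩) : x ∈ derived P p :=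
  atom_mem_derived hr (Set.empty_subset _)

end Rules

theorem contrary_mem_derived (l : Lit F) : .contrary l l.compl ∈ derived P p := by
  cases l with
  | pos f => exact fact_mem_derived (.contrary_pos f)
  | neg f => exact fact_mem_derived (.contrary_neg f)

variable {a : A} {l : Lit F}

theorem holdsSet_Cl_subset_derived (ht : t ∈ Set.Icc 1 (p.size + 1)) (hk : k ∈ Set.Icc 1 p.size)
    {σ : Set (Lit F)} (hσ : holdsSet σ t k ⊆ derived P p) :
    holdsSet (P.D.Cl σ) t k ⊆ derived P p := by
  have hclosed : P.D.SatStatics {l | Atom.holds l t k ∈ derived P p} := fun l φ hl hφ =>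
    atom_mem_derived (.static_holds l φ hl t k ht hk) (holdsSet_subset_iff.2 hφ)
  exact holdsSet_subset_iff.2 (Domain.Cl_subset (holdsSet_subset_iff.1 hσ) hclosed)

theorem eSet_e_subset_derived (ht : t ∈ Set.Icc 1 p.size) (hk : k ∈ Set.Icc 1 p.size)
    (hocc : .occ a t k ∈ derived P p) (hδ : holdsSet δ t k ⊆ derived P p) :
    eSet (P.D.e a δ) t k ⊆ derived P p := by
  have hdirect : P.D.direct a δ ⊆ {l | Atom.e l t k ∈ derived P p} := by
    rintro l ⟨φ, hl, hφ⟩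
    exact atom_mem_derived (.causes_e a l φ hl t k ht hk)
      (Set.union_subset (Set.singleton_subset_iff.2 hocc)
        (holdsSet_subset_iff.2 fun m hm => hδ ⟨m, hφ hm, rfl⟩))
  have hclosed : P.D.SatStatics {l | Atom.e l t k ∈ derived P p} := fun l φ hl hφ =>
    atom_mem_derived (.static_e l φ hl t k ht hk) (eSet_subset_iff.2 hφ)
  exact eSet_subset_iff.2 (Domain.Cl_subset hdirect hclosed)

theorem pc_mem_derived (hD : P.D.Admissible) (ht : t ∈ Set.Icc 1 p.size)
    (hk : k ∈ Set.Icc 1 p.size) (ha : Occurs P p a t k) (hocc : .occ a t k ∈ derived P p)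
    (hl : l ∈ P.D.pc a (known P p t k)) : .pc l t k ∈ derived P p := by
  have hneg {l : Lit F} {N : Set (Atom F A)} (hl : l ∉ known P p t k)
      (hN : N ∩ answerSet P p = ∅) : ({.holds l t k} ∪ N) ∩ answerSet P p = ∅ := by
    rw [Set.union_inter_distrib_right, hN, Set.union_empty, Set.singleton_inter_eq_empty]
    exact fun h => hl h.2
  obtain ⟨i, hi⟩ := Set.mem_iUnion.1 hl
  clear hl
  induction i generalizing l with
  | zero =>
    obtain ⟨φ, hφ, hl, hn⟩ := hi
    exact mem_derived_of_isRule (.causes_pc a l φ hφ t k ht hk) rfl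
      (Set.singleton_subset_iff.2 hocc)
      (hneg hl ((holdsSet_inter_answerSet_eq_empty_iff (Nat.le_succ_of_le ht.2) _).2 hn))
  | succ i ih =>
    rcases hi with hi | ⟨φ, hφ, hl, ⟨l', hl', hpc⟩, hn⟩
    · exact ih hi
    · exact mem_derived_of_isRule (.static_pc l φ hφ l' hl' t k ht hk) rfl
        (Set.singleton_subset_iff.2 (ih hpc))
        (hneg hl ((eSet_inter_answerSet_eq_empty_iff hD ha _).2 hn))

theorem holds_mem_derived_of_inertia (ht : t ∈ Set.Icc 1 p.size) (hk : k ∈ Set.Icc 1 p.size)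
    (hl : .holds l t k ∈ derived P p)
    (hpc : ∀ a, Occurs P p a t k → l.compl ∉ P.D.pc a (known P p t k)) :
    .holds l (t + 1) k ∈ derived P p :=
  mem_derived_of_isRule (.inertia l l.compl t k ht hk) rfl
    (Set.pair_subset hl (contrary_mem_derived l))
    (Set.singleton_inter_eq_empty.2 fun ⟨a, ha, h⟩ => hpc a ha h)

theorem Reach.occ_mem_derived_of_used (hD : P.D.Admissible)
    (hp : P.IsReducedSolution P.initialState p) (h : Reach P p t ⟨k, δ, q⟩)
    (hq : q.first = some a) (hused : .used t k ∈ derived P p) : .occ a t k ∈ derived P p := by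
  have ht := h.time_mem_Icc hD hq
  refine mem_derived_of_isRule (.occ_choice t k ht (h.path_mem_Icc hD)) ⟨⟨a, rfl⟩, δ, q, h, hq⟩
    (Set.singleton_subset_iff.2 hused) (Set.singleton_inter_eq_empty.2 ?_)
  rw [h.goal_mem_answerSet_iff hD hp (Nat.le_succ_of_le ht.2), hq]
  exact Option.some_ne_none a

theorem Reach.br_mem_derived_of_occ (hD : P.D.Admissible) {θ : Set (Lit F)}
    {ha : (a, θ) ∈ P.D.determines} {q : θ → Plan P.D} (h : Reach P p t ⟨k, δ, .sense a θ ha q⟩)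
    (hocc : .occ a t k ∈ derived P p) (g : θ) :
    .br g t k (k + offset (fun g => (q g).size) g) ∈ derived P p := by
  have hk' := (h.step (.sense _ _ _ _ _ _ g)).path_mem_Icc hD
  exact mem_derived_of_isRule
    (.determines_branch a θ ha g g.2 t k (h.time_mem_Icc hD rfl) (h.path_mem_Icc hD))
    ⟨⟨_, hk', Nat.le_add_right _ _, rfl⟩, h.branches g⟩ (Set.singleton_subset_iff.2 hocc)
    (Set.empty_inter _)

theorem Reach.used_mem_derived (hD : P.D.Admissible)
    (hp : P.IsReducedSolution P.initialState p) (h : Reach P p t c) (ht : t ≤ p.size + 1) :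
    .used t c.path ∈ derived P p := by
  induction h with
  | root => exact fact_mem_derived .used_root
  | @step t c c' h hs ih =>
    have ht' : t ∈ Set.Icc 1 p.size := ⟨h.one_le_time, by omega⟩
    have hused := ih (by omega)
    have hk := h.path_mem_Icc hD
    have hnext : .used (t + 1) c.path ∈ derived P p :=
      atom_mem_derived (.used_next t c.path ht' hk) (Set.singleton_subset_iff.2 hused)
    have hk' := (h.step hs).path_mem_Icc hD
    cases hs with
    | idle | act => exact hnext
    | sense k δ a θ ha q g =>
      have hbr := h.br_mem_derived_of_occ hD (h.occ_mem_derived_of_used hD hp rfl hused) g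
      rcases (Nat.le_add_right k (offset (fun g => (q g).size) g)).eq_or_lt with heq | hlt
      · exact heq ▸ hnext
      · exact atom_mem_derived (.branch_used g ⟨a, θ, ha, g.2⟩ t k _ ht' hk hk' hlt)
          (Set.singleton_subset_iff.2 hbr)

theorem Occurs.time_mem_Icc (hD : P.D.Admissible) (h : Occurs P p a t k) :
    t ∈ Set.Icc 1 p.size :=
  let ⟨_, _, h, ha⟩ := h
  h.time_mem_Icc hD ha

theorem Occurs.path_mem_Icc (hD : P.D.Admissible) (h : Occurs P p a t k) :
    k ∈ Set.Icc 1 p.size :=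
  let ⟨_, _, h, _⟩ := h
  h.path_mem_Icc hD

theorem Occurs.occ_mem_derived (hD : P.D.Admissible)
    (hp : P.IsReducedSolution P.initialState p) (ha : Occurs P p a t k) :
    .occ a t k ∈ derived P p := by
  have ht := Nat.le_succ_of_le (ha.time_mem_Icc hD).2
  obtain ⟨δ, q, h, hq⟩ := ha
  exact h.occ_mem_derived_of_used hD hp hq (h.used_mem_derived hD hp ht)

theorem Branches.br_mem_derived (hD : P.D.Admissible)
    (hp : P.IsReducedSolution P.initialState p) {g : Lit F} (hb : Branches P p g t k k') :
    .br g t k k' ∈ derived P p := by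
  obtain ⟨δ, a, θ, ha, q, hg, h, rfl⟩ := hb
  exact h.br_mem_derived_of_occ hD (((h.occurs_iff hD).2 rfl).occ_mem_derived hD hp) ⟨g, hg⟩

theorem Reach.holdsSet_subset_derived_of_act (hD : P.D.Admissible)
    (hp : P.IsReducedSolution P.initialState p) {ha : ¬ P.D.IsSensing a}
    (h : Reach P p t ⟨k, δ, .act a ha q⟩) (hδ : holdsSet δ t k ⊆ derived P p) :
    holdsSet (P.D.next a δ) (t + 1) k ⊆ derived P p := by
  have ht := h.time_mem_Icc hD rfl
  have hk := h.path_mem_Icc hD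
  have hocc := (h.occurs_iff hD).2 rfl
  refine holdsSet_Cl_subset_derived ⟨Nat.le_add_left _ _, Nat.succ_le_succ ht.2⟩ hk
    (holdsSet_subset_iff.2 ?_)
  rintro l (hl | ⟨hl, hpc⟩)
  · have he := eSet_e_subset_derived ht hk (hocc.occ_mem_derived hD hp) hδ ⟨l, hl, rfl⟩
    exact atom_mem_derived (.effect l t k ht hk) (Set.singleton_subset_iff.2 he)
  · refine holds_mem_derived_of_inertia ht hk (hδ ⟨l, hl, rfl⟩) fun b hb hl' => hpc ?_
    obtain rfl := hocc.unique hD hb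
    rw [h.known_eq hD] at hl'
    exact ⟨_, hl', Lit.compl_compl l⟩

theorem Branches.holdsSet_subset_derived (hD : P.D.Admissible)
    (hp : P.IsReducedSolution P.initialState p) {g : Lit F} (hb : Branches P p g t k k')
    (hδ : holdsSet (known P p t k) t k ⊆ derived P p) :
    holdsSet (P.D.Cl (known P p t k ∪ {g})) (t + 1) k' ⊆ derived P p := by
  have hbr := hb.br_mem_derived hD hp
  obtain ⟨q', h'⟩ := hb.exists_reach hD
  have hk' := h'.path_mem_Icc hD
  obtain ⟨δ, a, θ, ha, q, hg, h, hkk'⟩ := hb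
  have hle : k ≤ k' := hkk' ▸ Nat.le_add_right _ _
  have ht := h.time_mem_Icc hD rfl
  have hk := h.path_mem_Icc hD
  have hs : g ∈ P.D.sensed := ⟨a, θ, ha, hg⟩
  refine holdsSet_Cl_subset_derived ⟨Nat.le_add_left _ _, Nat.succ_le_succ ht.2⟩ hk'
    (holdsSet_subset_iff.2 ?_)
  rintro l (hl | rfl)
  · rcases hle.eq_or_lt with rfl | hlt
    · refine holds_mem_derived_of_inertia ht hk (hδ ⟨l, hl, rfl⟩) fun b hb => ?_
      obtain rfl := hb.unique hD ((h.occurs_iff hD).2 rfl)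
      rw [hD.pc_sensing ⟨θ, ha⟩]
      exact Set.notMem_empty _
    · exact atom_mem_derived (.branch_inherit g hs l t k k' ht hk hk' hlt)
        (Set.pair_subset hbr (hδ ⟨l, hl, rfl⟩))
  · exact atom_mem_derived (.branch_sensed l hs t k k' ht hk hk' hle)
      (Set.singleton_subset_iff.2 hbr)

theorem Reach.holdsSet_subset_derived (hD : P.D.Admissible)
    (hp : P.IsReducedSolution P.initialState p) (h : Reach P p t c) (ht : t ≤ p.size + 1) :
    holdsSet c.known t c.path ⊆ derived P p := by
  induction h with
  | root =>
    exact holdsSet_Cl_subset_derived ⟨le_rfl, ht⟩ (Reach.root.path_mem_Icc hD)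
      (holdsSet_subset_iff.2 fun l hl => fact_mem_derived (.initially l hl))
  | @step t c c' h hs ih =>
    have ht' : t ∈ Set.Icc 1 p.size := ⟨h.one_le_time, by omega⟩
    have hδ := ih (by omega)
    cases hs with
    | idle k δ =>
      refine holdsSet_subset_iff.2 fun l hl => holds_mem_derived_of_inertia ht'
        (h.path_mem_Icc hD) (hδ ⟨l, hl, rfl⟩) fun a ha => ?_
      cases (h.occurs_iff hD).1 ha
    | act => exact h.holdsSet_subset_derived_of_act hD hp hδ
    | sense k δ a θ ha q g =>
      have hb := (h.branches g).holdsSet_subset_derived hD hp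
      rw [h.known_eq hD] at hb
      exact hb hδ

theorem holdsSet_known_subset_derived (hD : P.D.Admissible)
    (hp : P.IsReducedSolution P.initialState p) (ht : t ≤ p.size + 1) :
    holdsSet (known P p t k) t k ⊆ derived P p := by
  rintro _ ⟨l, ⟨δ, q, h, hl⟩, rfl⟩
  exact h.holdsSet_subset_derived hD hp ht ⟨l, hl, rfl⟩

theorem poss_mem_derived (hD : P.D.Admissible) (hp : P.IsReducedSolution P.initialState p)
    (ht : t ∈ Set.Icc 1 p.size) (hk : k ∈ Set.Icc 1 p.size)
    (ha : P.D.Executable a (known P p t k)) : .poss a t k ∈ derived P p := by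
  obtain ⟨ψ, ha, hψ⟩ := ha
  have hδ := holdsSet_known_subset_derived hD hp (k := k) (Nat.le_succ_of_le ht.2)
  exact atom_mem_derived (.executable a ψ ha t k ht hk)
    (holdsSet_subset_iff.2 fun l hl => hδ ⟨l, hψ hl, rfl⟩)

theorem goal_mem_derived (hD : P.D.Admissible) (hp : P.IsReducedSolution P.initialState p)
    (ht : t ∈ Set.Icc 1 (p.size + 1)) (hk : k ∈ Set.Icc 1 p.size)
    (h : P.G ⊆ known P p t k ∨ ¬ Consistent (known P p t k)) : .goal t k ∈ derived P p := by
  have hδ := holdsSet_known_subset_derived hD hp (k := k) ht.2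
  rcases h with hG | hc
  · exact atom_mem_derived (.goal t k ht hk)
      (holdsSet_subset_iff.2 fun l hl => hδ ⟨l, hG hl, rfl⟩)
  · simp only [Consistent, not_forall, not_not] at hc
    obtain ⟨l, hl, hl'⟩ := hc
    exact atom_mem_derived (.goal_inconsistent l l.compl t k ht hk)
      (Set.insert_subset (contrary_mem_derived l)
        (Set.pair_subset (hδ ⟨l, hl, rfl⟩) (hδ ⟨_, hl', rfl⟩)))

theorem answerSet_subset_derived (hD : P.D.Admissible)
    (hp : P.IsReducedSolution P.initialState p) : answerSet P p ⊆ derived P p := by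
  intro x hx
  replace hx : InAnswerSet P p x := hx
  cases x with
  | time t => exact fact_mem_derived (.time t hx)
  | time1 t => exact fact_mem_derived (.time1 t hx)
  | path k => exact fact_mem_derived (.path k hx)
  | fluent f => exact fact_mem_derived (.fluent f)
  | literal l =>
    cases l with
    | pos f => exact fact_mem_derived (.literal_pos f)
    | neg f => exact fact_mem_derived (.literal_neg f)
  | contrary l l' =>
    obtain rfl : l' = l.compl := hx
    exact contrary_mem_derived l
  | isSensed g => exact fact_mem_derived (.isSensed g hx)
  | action a => exact fact_mem_derived (.action a)
  | holds l t k => exact holdsSet_known_subset_derived hD hp hx.1 ⟨l, hx.2, rfl⟩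
  | poss a t k => exact poss_mem_derived hD hp hx.1 hx.2.1 hx.2.2
  | occ a t k => exact Occurs.occ_mem_derived hD hp hx
  | e l t k =>
    obtain ⟨a, ha, hl⟩ := hx
    have ht := ha.time_mem_Icc hD
    exact eSet_e_subset_derived ht (ha.path_mem_Icc hD) (ha.occ_mem_derived hD hp)
      (holdsSet_known_subset_derived hD hp (Nat.le_succ_of_le ht.2)) ⟨l, hl, rfl⟩
  | pc l t k =>
    obtain ⟨a, ha, hl⟩ := hx
    exact pc_mem_derived hD (ha.time_mem_Icc hD) (ha.path_mem_Icc hD) ha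
      (ha.occ_mem_derived hD hp) hl
  | goal t k => exact goal_mem_derived hD hp hx.1 hx.2.1 hx.2.2
  | br g t k k' => exact Branches.br_mem_derived hD hp hx
  | used t k =>
    obtain ⟨ht, δ, q, h⟩ := hx
    exact h.used_mem_derived hD hp ht
  | newBr k k' => exact fact_mem_derived (.newBr k k' hx.1 hx.2.2 hx.2.1)

theorem isAnswerSet_answerSet (hD : P.D.Admissible)
    (hp : P.IsReducedSolution P.initialState p) :
    IsAnswerSet (program P p.size p.size) (answerSet P p) :=
  have hsat := sat_answerSet_of_mem_program hD hp
  ⟨hsat, (answerSet_subset_derived hD hp).antisymm (leastModel_glReduct_subset hsat)⟩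

/-! ## Extraction of the plan -/

theorem Reach.extracts (hD : P.D.Admissible) (h : Reach P p t ⟨k, δ, q⟩) :
    Extracts P.D p.size (answerSet P p) t k q := by
  induction q generalizing t k δ with
  | empty => exact .empty _ _ (Or.inr fun a ha => nomatch (h.occurs_iff hD).1 ha)
  | act a ha q ih =>
    exact .act _ _ (h.time_mem_Icc hD rfl).2 a ha ((h.occurs_iff hD).2 rfl) q
      (ih (h.step (.act _ _ _ _ _)))
  | sense a θ ha q ih =>
    exact .sense _ _ (h.time_mem_Icc hD rfl).2 a θ ha ((h.occurs_iff hD).2 rfl) _ h.branches q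
      fun g => ih g (h.step (.sense _ _ _ _ _ _ g))

theorem Reach.eq_of_extracts (hD : P.D.Admissible) {r : Plan P.D} (h : Reach P p t ⟨k, δ, q⟩)
    (hr : Extracts P.D p.size (answerSet P p) t k r) : r = q := by
  induction hr generalizing δ q with
  | empty t k hend =>
    have hq : q.first = none := Option.eq_none_iff_forall_ne_some.2 fun a ha => by
      have ht := (h.time_mem_Icc hD ha).2
      exact hend.resolve_left (by omega) a ((h.occurs_iff hD).2 ha)
    exact (Plan.eq_empty_of_first_eq_none hq).symm
  | act t k _ a ha hocc r _ ih =>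
    obtain ⟨q, rfl⟩ := Plan.eq_act_of_first ((h.occurs_iff hD).1 hocc) ha
    rw [ih (h.step (.act _ _ _ _ _))]
  | sense t k _ a θ ha hocc κ hκ r _ ih =>
    obtain ⟨q, rfl⟩ := Plan.eq_sense_of_first hD ((h.occurs_iff hD).1 hocc) ha
    have hrq (g : θ) : r g = q g := by
      refine ih g (δ := P.D.Cl (δ ∪ {g.1})) ?_
      rw [(h.branches_iff hD g).1 (hκ g)]
      exact h.step (.sense _ _ _ _ _ _ g)
    rw [funext hrq]

end Execution

end ASCP

theorem theorem3p2_general {F A : Type*} (P : ASCP.Problem F A) (hD : P.D.Admissible)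
    (hδ : ASCP.Consistent P.initialState) (p : ASCP.Plan P.D) (hp : P.IsSolution p) :
    ∃ h w : ℕ, 1 ≤ h ∧ 1 ≤ w ∧ ∃ S : Set (ASCP.Atom F A),
      ASCP.IsAnswerSet (ASCP.program P h w) S ∧
      ∀ q : ASCP.Plan P.D,
        ASCP.Extracts P.D h S 1 1 q ↔ q = P.reduct p P.initialState := by
  have hreduct : P.IsReducedSolution P.initialState (P.reduct p P.initialState) :=
    ASCP.Problem.Solves.isReducedSolution_reduct hp ⟨hδ, ASCP.Domain.satStatics_Cl _⟩
  have hsize := (P.reduct p P.initialState).size_pos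
  refine ⟨_, _, hsize, hsize, _, ASCP.isAnswerSet_answerSet hD hreduct, fun q => ?_⟩
  exact ⟨ASCP.Reach.root.eq_of_extracts hD, fun hq => hq ▸ ASCP.Reach.root.extracts hD⟩

theorem theorem3p2 {F A : Type*} [Finite F] [Finite A] (P : ASCP.Problem F A)
    (hwf : P.D.WellFormed) (hG : P.G.Nonempty) (hcons : P.IsConsistent)
    (p : ASCP.Plan P.D) (hp : P.IsSolution p) :
    ∃ h w : ℕ, 1 ≤ h ∧ 1 ≤ w ∧ ∃ S : Set (ASCP.Atom F A),
      ASCP.IsAnswerSet (ASCP.program P h w) S ∧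
      ∀ q : ASCP.Plan P.D,
        ASCP.Extracts P.D h S 1 1 q ↔ q = P.reduct p P.initialState :=
  theorem3p2_general P hwf.admissible hcons.2.1.1 p hp
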